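/- Let $N$ be a nontrivial torsion-free finitely generated nilpotent group and let $S$ be a finite generating subset of $N$. For $g\in N$ let $\|g\|_S$ be the word length of $g$ with respect to $S$ (the least length of a word in elements of $S$ and their inverses representing $g$). For a finite subset $X\subseteq N$ put $\|X\|_S=\max\{\|x\|_S : x\in X\}$ (with $\|\emptyset\|_S=0$), and for a finitely generated subgroup $H\le N$ put $$\|H\|_S=\min\{\|X\|_S : X \text{ is a finite generating subset of } H\}.$$ For $H\le N$ and $g\in N\setminus H$ let $$\mathrm{D}_N(H,g)=\min\{|Q| : Q \text{ is a finite group and there is a homomorphism } \pi:N\to Q \text{ with } \pi(g)\notin\pi(H)\}\in\mathbb{N}\cup\{\infty\},$$ where the minimum over the empty set is $\infty$. For $n\in\mathbb{N}=\{0,1,2,\dots\}$ let $$\mathrm{Sub}_{N,S}(n)=\max\{\mathrm{D}_N(H,g) : H\le N \text{ finitely generated},\ g\in N\setminus H,\ \|H\|_S\le n,\ \|g\|_S\le n\},$$ where the maximum over the empty set is $0$ (and the maximum is read as a supremum in $\mathbb{N}\cup\{\infty\}$). For functions $f,g:\mathbb{N}\to\mathbb{N}\cup\{\infty\}$ write $f(n)\preceq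 g(n)$ if there is a $C\in\mathbb{N}$ with $f(n)\le C\,g(Cn)$ for all $n\in\mathbb{N}$. Then there exists a $k\in\mathbb{N}$ such that $$n\preceq \mathrm{Sub}_{N,S}(n)\preceq n^k.$$ In particular, $\mathrm{Sub}_{N,S}(n)$ is finite for every $n$. -/

import Mathlib

namespace SubgroupSeparability

/-- The word length of `g` with respect to `S`: the least length of a word in the elements of `S`
and their inverses which represents `g` (it is `⊤` if there is no such word). -/
noncomputable def wordNorm {G : Type*} [Group G] (S : Finset G) (g : G) : ℕ∞ :=
  ⨅ (l : List G) (_ : (∀ x ∈ l, x ∈ S ∨ x⁻¹ ∈ S) ∧ l.prod = g), (l.length : ℕ∞)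

/-- The norm of a finite subset `X`: the maximal word length of an element of `X`
(and `0` if `X` is empty). -/
noncomputable def finsetNorm {G : Type*} [Group G] (S X : Finset G) : ℕ∞ :=
  X.sup (wordNorm S)

/-- The norm of a subgroup `H`: the minimal norm of a finite generating subset of `H`
(it is `⊤` if `H` is not finitely generated). -/
noncomputable def subgroupNorm {G : Type*} [Group G] (S : Finset G) (H : Subgroup G) : ℕ∞ :=
  ⨅ (X : Finset G) (_ : Subgroup.closure (X : Set G) = H), finsetNorm S X

/-- The relative depth `D_G(H, g)`: the minimal order of a finite group `Q` which admits a group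
morphism `π : G → Q` such that `π g ∉ π H` (it is `⊤` if there is no such `Q`).
Every finite group is isomorphic to one in `Type`. -/
noncomputable def depth {G : Type*} [Group G] (H : Subgroup G) (g : G) : ℕ∞ :=
  sInf {d : ℕ∞ | ∃ (Q : Type) (_ : Group Q) (_ : Finite Q) (π : G →* Q),
    π g ∉ H.map π ∧ d = (Nat.card Q : ℕ∞)}

/-- The subgroup separability function `Sub_{G,S}`: its value at `n` is the maximum of `D_G(H, g)`
over all finitely generated subgroups `H` and elements `g ∉ H` of norm at most `n`.
The supremum in `ℕ∞` is `0` on the empty set, and is attained whenever it is finite and the set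
is not empty. -/
noncomputable def sepFun {G : Type*} [Group G] (S : Finset G) (n : ℕ) : ℕ∞ :=
  sSup {d : ℕ∞ | ∃ (H : Subgroup G) (g : G), H.FG ∧ g ∉ H ∧
    subgroupNorm S H ≤ n ∧ wordNorm S g ≤ n ∧ d = depth H g}

/-- The asymptotic comparison `f ≼ g`: there is a natural number `C` such that
`f n ≤ C * g (C * n)` for all `n`. -/
def Dominated (f g : ℕ → ℕ∞) : Prop :=
  ∃ C : ℕ, ∀ n : ℕ, f n ≤ (C : ℕ∞) * g (C * n)

end SubgroupSeparability

namespace SubgroupSeparability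

/-! ### Word balls -/

/-- The elements represented by words of length at most `r` in the elements of `S` and their
inverses. -/
def wordBall {G : Type*} [Group G] (S : Set G) (r : ℕ) : Set G :=
  {g | ∃ l : List G, (∀ x ∈ l, x ∈ S ∨ x⁻¹ ∈ S) ∧ l.prod = g ∧ l.length ≤ r}

section wordBall

variable {G H : Type*} [Group G] [Group H] {S T : Set G} {g h : G} {m n r : ℕ}

theorem wordBall_mono (hmn : m ≤ n) (hg : g ∈ wordBall S m) : g ∈ wordBall S n := by
  obtain ⟨l, hl, hp, hn⟩ := hg
  exact ⟨l, hl, hp, hn.trans hmn⟩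

theorem one_mem_wordBall : (1 : G) ∈ wordBall S r := ⟨[], by simp, by simp, by simp⟩

theorem mem_wordBall_of_mem (hg : g ∈ S) : g ∈ wordBall S 1 := ⟨[g], by simp [hg], by simp, by simp⟩

theorem mul_mem_wordBall (hg : g ∈ wordBall S m) (hh : h ∈ wordBall S n) :
    g * h ∈ wordBall S (m + n) := by
  obtain ⟨l, hl, rfl, hm⟩ := hg
  obtain ⟨l', hl', rfl, hn⟩ := hh
  refine ⟨l ++ l', fun x hx => ?_, by simp, by simp; omega⟩
  rcases List.mem_append.1 hx with hx | hx
  exacts [hl x hx, hl' x hx]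

theorem inv_mem_wordBall (hg : g ∈ wordBall S m) : g⁻¹ ∈ wordBall S m := by
  obtain ⟨l, hl, rfl, hm⟩ := hg
  refine ⟨(l.map (·⁻¹)).reverse, fun x hx => ?_, (List.prod_inv_reverse l).symm, by simpa⟩
  obtain ⟨y, hy, rfl⟩ := List.mem_map.1 (List.mem_reverse.1 hx)
  simpa using (hl y hy).symm

theorem pow_mem_wordBall (hg : g ∈ wordBall S m) (k : ℕ) : g ^ k ∈ wordBall S (k * m) := by
  induction k with
  | zero => simpa using one_mem_wordBall
  | succ k ih =>
    rw [pow_succ, Nat.succ_mul]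
    exact mul_mem_wordBall ih hg

theorem zpow_mem_wordBall (hg : g ∈ wordBall S m) (k : ℤ) :
    g ^ k ∈ wordBall S (k.natAbs * m) := by
  rcases Int.natAbs_eq k with h | h
  · rw [h, zpow_natCast]
    exact pow_mem_wordBall hg _
  · rw [h, zpow_neg, zpow_natCast, Int.natAbs_neg]
    exact inv_mem_wordBall (pow_mem_wordBall hg _)

theorem wordBall_induction {motive : ℕ → G → Prop} (one : ∀ r, motive r 1)
    (cons : ∀ r x g, (x ∈ S ∨ x⁻¹ ∈ S) → g ∈ wordBall S r → motive r g → motive (r + 1) (x * g))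
    (hg : g ∈ wordBall S r) : motive r g := by
  obtain ⟨l, hl, rfl, hm⟩ := hg
  induction l generalizing r with
  | nil => exact one r
  | cons x l ih =>
    obtain ⟨r, rfl⟩ : ∃ s, r = s + 1 := ⟨r - 1, by simp at hm; omega⟩
    have hm' : l.length ≤ r := by simpa using hm
    rw [List.prod_cons]
    have hl' : ∀ y ∈ l, y ∈ S ∨ y⁻¹ ∈ S := fun y hy => hl y (List.mem_cons_of_mem _ hy)
    exact cons r x _ (hl x List.mem_cons_self) ⟨l, hl', rfl, hm'⟩ (ih hl' hm')

theorem wordBall_trans (hST : ∀ s ∈ S, s ∈ wordBall T m) (hg : g ∈ wordBall S r) :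
    g ∈ wordBall T (r * m) := by
  refine wordBall_induction (motive := fun r g => g ∈ wordBall T (r * m))
    (fun _ => one_mem_wordBall) (fun r x g hx _ ih => ?_) hg
  rw [Nat.succ_mul, Nat.add_comm]
  refine mul_mem_wordBall ?_ ih
  rcases hx with hx | hx
  · exact hST x hx
  · simpa using inv_mem_wordBall (hST _ hx)

theorem map_mem_wordBall (f : G →* H) (hg : g ∈ wordBall S r) : f g ∈ wordBall (f '' S) r := by
  refine wordBall_induction (motive := fun r g => f g ∈ wordBall (f '' S) r)
    (fun _ => by simpa using one_mem_wordBall) (fun r x g hx _ ih => ?_) hg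
  rw [map_mul, Nat.add_comm]
  refine mul_mem_wordBall ?_ ih
  rcases hx with hx | hx
  · exact mem_wordBall_of_mem ⟨x, hx, rfl⟩
  · have := inv_mem_wordBall (mem_wordBall_of_mem (Set.mem_image_of_mem f hx))
    simpa using this

theorem exists_mem_wordBall (hg : g ∈ Subgroup.closure S) : ∃ r, g ∈ wordBall S r := by
  induction hg using Subgroup.closure_induction with
  | mem x hx => exact ⟨1, mem_wordBall_of_mem hx⟩
  | one => exact ⟨0, one_mem_wordBall⟩
  | mul x y _ _ hx hy =>
    obtain ⟨⟨m, hm⟩, n, hn⟩ := And.intro hx hy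
    exact ⟨m + n, mul_mem_wordBall hm hn⟩
  | inv x _ hx =>
    obtain ⟨m, hm⟩ := hx
    exact ⟨m, inv_mem_wordBall hm⟩

theorem wordBall_subset_closure (hg : g ∈ wordBall S r) : g ∈ Subgroup.closure S := by
  refine wordBall_induction (motive := fun _ g => g ∈ Subgroup.closure S)
    (fun _ => one_mem _) (fun r x g hx _ ih => mul_mem ?_ ih) hg
  rcases hx with hx | hx
  · exact Subgroup.subset_closure hx
  · simpa using inv_mem (Subgroup.subset_closure hx)

theorem wordNorm_le_iff {S : Finset G} : wordNorm S g ≤ n ↔ g ∈ wordBall (S : Set G) n := by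
  constructor
  · intro h
    have h' : wordNorm S g < ((n + 1 : ℕ) : ℕ∞) :=
      lt_of_le_of_lt h (by exact_mod_cast Nat.lt_succ_self n)
    simp only [wordNorm, iInf_lt_iff] at h'
    obtain ⟨l, ⟨hl, hp⟩, hlt⟩ := h'
    exact ⟨l, hl, hp, Nat.lt_succ_iff.1 (by exact_mod_cast hlt)⟩
  · rintro ⟨l, hl, hp, hn⟩
    exact (iInf₂_le l ⟨hl, hp⟩).trans (by exact_mod_cast hn)

theorem exists_of_subgroupNorm_le {S : Finset G} {H : Subgroup G} (h : subgroupNorm S H ≤ n) :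
    ∃ X : Finset G, Subgroup.closure (X : Set G) = H ∧ ∀ x ∈ X, x ∈ wordBall (S : Set G) n := by
  have h' : subgroupNorm S H < ((n + 1 : ℕ) : ℕ∞) :=
    lt_of_le_of_lt h (by exact_mod_cast Nat.lt_succ_self n)
  simp only [subgroupNorm, iInf_lt_iff] at h'
  obtain ⟨X, hX, hlt⟩ := h'
  refine ⟨X, hX, fun x hx => wordNorm_le_iff.1 ?_⟩
  have h1 : wordNorm S x ≤ finsetNorm S X := Finset.le_sup hx
  have h2 : finsetNorm S X ≤ n := by
    rw [Nat.cast_add, Nat.cast_one] at hlt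
    exact ENat.lt_add_one_iff (ENat.natCast_ne_top n) |>.1 hlt
  exact h1.trans h2

end wordBall

/-! ### Polynomial bounds -/

/-- The function `f` is bounded by a polynomial. -/
def PolyBound (f : ℕ → ℕ) : Prop := ∃ k : ℕ, ∀ n, f n ≤ (n + 2) ^ k

namespace PolyBound

variable {f g : ℕ → ℕ}

theorem mono (hg : PolyBound g) (h : ∀ n, f n ≤ g n) : PolyBound f := by
  obtain ⟨k, hk⟩ := hg
  exact ⟨k, fun n => (h n).trans (hk n)⟩

theorem const (c : ℕ) : PolyBound fun _ => c :=
  ⟨c, fun n => (Nat.lt_two_pow_self.le).trans (Nat.pow_le_pow_left (by omega) c)⟩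

theorem id : PolyBound fun n => n := ⟨1, fun n => by simp⟩

theorem mul (hf : PolyBound f) (hg : PolyBound g) : PolyBound fun n => f n * g n := by
  obtain ⟨⟨k, hk⟩, l, hl⟩ := And.intro hf hg
  exact ⟨k + l, fun n => by rw [pow_add]; exact Nat.mul_le_mul (hk n) (hl n)⟩

theorem add (hf : PolyBound f) (hg : PolyBound g) : PolyBound fun n => f n + g n := by
  obtain ⟨⟨k, hk⟩, l, hl⟩ := And.intro hf hg
  refine ⟨k + l + 1, fun n => ?_⟩
  have h1 : (n + 2) ^ k ≤ (n + 2) ^ (k + l) := Nat.pow_le_pow_right (by omega) (by omega)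
  have h2 : (n + 2) ^ l ≤ (n + 2) ^ (k + l) := Nat.pow_le_pow_right (by omega) (by omega)
  have h3 : (n + 2) ^ (k + l) * 2 ≤ (n + 2) ^ (k + l) * (n + 2) :=
    Nat.mul_le_mul_left _ (by omega)
  rw [pow_succ]
  linarith [hk n, hl n]

theorem pow (hf : PolyBound f) (e : ℕ) : PolyBound fun n => f n ^ e := by
  obtain ⟨k, hk⟩ := hf
  exact ⟨k * e, fun n => by rw [pow_mul]; exact Nat.pow_le_pow_left (hk n) e⟩

theorem comp (hf : PolyBound f) (hg : PolyBound g) : PolyBound fun n => f (g n) := by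
  obtain ⟨k, hk⟩ := hf
  exact ((hg.add (const 2)).pow k).mono fun n => hk (g n)

end PolyBound

theorem polyBound_pow (k : ℕ) : PolyBound fun n => (n + 2) ^ k := ⟨k, fun _ => le_rfl⟩

/-! ### Central series with cyclic factors -/

/-- `HasCyclicCentralSeries d N`: the group `N` is obtained from the trivial group by `d`
successive central extensions with cyclic kernel. -/
def HasCyclicCentralSeries : ℕ → ∀ (N : Type*) [Group N], Prop
  | 0, N, _ => Subsingleton N
  | d + 1, N, _ => ∃ (N' : Type _) (_ : Group N') (f : N →* N') (z : N),
      Function.Surjective f ∧ z ∈ Subgroup.center N ∧ f.ker = Subgroup.zpowers z ∧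
        HasCyclicCentralSeries d N'

universe u v

theorem hasCyclicCentralSeries_of_central_ker {ι : Type*} (T : Finset ι) {N N' : Type u}
    [Group N] [Group N']
    {d : ℕ} (h : HasCyclicCentralSeries d N') (f : N →* N') (hf : Function.Surjective f)
    (t : ι → N) (ht : ∀ i ∈ T, t i ∈ Subgroup.center N)
    (hker : f.ker = Subgroup.closure (t '' T)) :
    ∃ e, HasCyclicCentralSeries e N := by
  classical
  induction T using Finset.induction_on generalizing N with
  | empty =>
    have hbot : f.ker = ⊥ := by simpa using hker
    let e : N' ≃* N := (MulEquiv.ofBijective f ⟨(MonoidHom.ker_eq_bot_iff f).1 hbot, hf⟩).symm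
    refine ⟨d + 1, N', ‹_›, f, 1, hf, one_mem _, by simpa using hbot, h⟩
  | insert i T hi ih =>
    have hz : t i ∈ Subgroup.center N := ht i (Finset.mem_insert_self _ _)
    have hZ : (Subgroup.zpowers (t i)).Normal :=
      ⟨fun n hn g => by
        have : n ∈ Subgroup.center N := (Subgroup.zpowers_le.2 hz) hn
        rwa [Subgroup.mem_center_iff.1 this g, mul_inv_cancel_right]⟩
    have hle : Subgroup.zpowers (t i) ≤ f.ker := by
      rw [hker, Subgroup.zpowers_le]
      exact Subgroup.subset_closure ⟨i, by simp, rfl⟩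
    let q := QuotientGroup.mk' (Subgroup.zpowers (t i))
    have hq : Function.Surjective q := QuotientGroup.mk'_surjective _
    obtain ⟨e, he⟩ := ih (QuotientGroup.lift _ f hle)
      (fun y => by obtain ⟨x, rfl⟩ := hf y; exact ⟨q x, rfl⟩) (fun j => q (t j))
      (fun j hj => by
        rw [Subgroup.mem_center_iff]
        intro g
        obtain ⟨g, rfl⟩ := hq g
        rw [← map_mul, ← map_mul,
          Subgroup.mem_center_iff.1 (ht j (Finset.mem_insert_of_mem hj)) g])
      (by
        rw [show (fun j => q (t j)) '' (T : Set ι) = q '' (t '' T) by rw [Set.image_image],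
          ← MonoidHom.map_closure]
        apply Subgroup.comap_injective hq
        rw [Subgroup.comap_map_eq, QuotientGroup.ker_mk', MonoidHom.comap_ker]
        change f.ker = _
        rw [hker, Finset.coe_insert, Set.image_insert_eq, Set.insert_eq, Subgroup.closure_union,
          ← Subgroup.zpowers_eq_closure, sup_comm])
    exact ⟨e + 1, _, _, q, t i, hq, hz, QuotientGroup.ker_mk' _, he⟩

open Subgroup
open scoped commutatorElement

theorem commutatorElement_mul_left_of_central {G : Type*} [Group G] {a b s : G}
    (h : ⁅b, s⁆ ∈ center G) : ⁅a * b, s⁆ = ⁅a, s⁆ * ⁅b, s⁆ := by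
  have := mem_center_iff.1 h (a * s * a⁻¹ * s⁻¹)
  calc ⁅a * b, s⁆ = a * ⁅b, s⁆ * (s * a⁻¹ * s⁻¹) := by simp only [commutatorElement_def]; group
    _ = ⁅b, s⁆ * a * (s * a⁻¹ * s⁻¹) := by rw [mem_center_iff.1 h a]
    _ = ⁅a, s⁆ * ⁅b, s⁆ := by rw [commutatorElement_def a, this]; group

theorem commutatorElement_mul_right_of_central {G : Type*} [Group G] {a s t : G}
    (h : ⁅a, t⁆ ∈ center G) : ⁅a, s * t⁆ = ⁅a, s⁆ * ⁅a, t⁆ := by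
  calc ⁅a, s * t⁆ = a * s * a⁻¹ * (⁅a, t⁆ * s⁻¹) := by simp only [commutatorElement_def]; group
    _ = ⁅a, s⁆ * ⁅a, t⁆ := by
      rw [← mem_center_iff.1 h s⁻¹, commutatorElement_def a s]; group

/-- If `⁅K, G⁆` is central, then it is generated by the commutators of generators, where `K` has to
be generated only up to central elements. -/
theorem commutator_top_eq_closure {G : Type*} [Group G] (K : Subgroup G) (Y S : Set G)
    (hS : closure S = ⊤) (hK : K ≤ closure Y ⊔ center G) (hYK : Y ⊆ K)
    (hc : ⁅K, (⊤ : Subgroup G)⁆ ≤ center G) :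
    ⁅K, (⊤ : Subgroup G)⁆ = closure (Set.image2 (fun y s => ⁅y, s⁆) Y S) := by
  have hcK : ∀ k ∈ K, ∀ g, ⁅k, g⁆ ∈ center G := fun k hk g =>
    hc (commutator_mem_commutator hk (mem_top g))
  set W := closure (Set.image2 (fun y s => ⁅y, s⁆) Y S)
  have h1 : ∀ y ∈ Y, ∀ g, ⁅y, g⁆ ∈ W := by
    intro y hy g
    have hg : g ∈ closure S := hS ▸ mem_top g
    induction hg using closure_induction with
    | mem s hs => exact subset_closure ⟨y, hy, s, hs, rfl⟩
    | one => simp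
    | mul a b _ _ ha hb =>
      rw [commutatorElement_mul_right_of_central (hcK y (hYK hy) b)]
      exact mul_mem ha hb
    | inv a _ ha =>
      have h := commutatorElement_mul_right_of_central (s := a) (hcK y (hYK hy) a⁻¹)
      rw [mul_inv_cancel, commutatorElement_one_right] at h
      rw [← inv_eq_of_mul_eq_one_right h.symm]
      exact inv_mem ha
  have h2 : ∀ k ∈ closure Y, ∀ g, ⁅k, g⁆ ∈ W := by
    intro k hk g
    have hle : closure Y ≤ K := (closure_le K).2 hYK
    induction hk using closure_induction with
    | mem y hy => exact h1 y hy g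
    | one => simp
    | mul a b _ hb' ha hb =>
      rw [commutatorElement_mul_left_of_central (hcK b (hle hb') g)]
      exact mul_mem ha hb
    | inv a ha' ha =>
      have h := commutatorElement_mul_left_of_central (a := a) (hcK a⁻¹ (inv_mem (hle ha')) g)
      rw [mul_inv_cancel, commutatorElement_one_left] at h
      rw [← inv_eq_of_mul_eq_one_right h.symm]
      exact inv_mem ha
  apply le_antisymm
  · rw [commutator_le]
    intro k hk g _
    obtain ⟨a, ha, z, hz, rfl⟩ := mem_sup_of_normal_right.1 (hK hk)
    have hzg : ⁅z, g⁆ = 1 := by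
      rw [commutatorElement_eq_one_iff_mul_comm, mem_center_iff.1 hz g]
    rw [commutatorElement_mul_left_of_central (by rw [hzg]; exact one_mem _), hzg, mul_one]
    exact h2 a ha g
  · rw [closure_le]
    rintro _ ⟨y, hy, s, -, rfl⟩
    exact commutator_mem_commutator (hYK hy) (mem_top s)

theorem lowerCentralSeries_le_center {G : Type*} [Group G] {c : ℕ}
    (h : (⊤ : Subgroup G).lowerCentralSeries (c + 1) = ⊥) :
    (⊤ : Subgroup G).lowerCentralSeries c ≤ center G := by
  intro x hx
  rw [mem_center_iff]
  intro g
  have : ⁅x, g⁆ ∈ (⊤ : Subgroup G).lowerCentralSeries (c + 1) :=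
    commutator_mem_commutator hx (mem_top g)
  rw [h, mem_bot, commutatorElement_eq_one_iff_mul_comm] at this
  exact this.symm

/-- The last nontrivial term of the lower central series of a finitely generated nilpotent group is
finitely generated. -/
theorem fg_lowerCentralSeries (c : ℕ) {G : Type u} [Group G] {S : Set G} (hS : S.Finite)
    (hSG : closure S = ⊤) (h : (⊤ : Subgroup G).lowerCentralSeries (c + 1) = ⊥) :
    ((⊤ : Subgroup G).lowerCentralSeries c).FG := by
  induction c generalizing G with
  | zero =>
    rw [Subgroup.lowerCentralSeries_zero]
    exact (Subgroup.fg_iff _).2 ⟨S, hSG, hS⟩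
  | succ c ih =>
    set A := (⊤ : Subgroup G).lowerCentralSeries (c + 1)
    have hA : A ≤ center G := lowerCentralSeries_le_center h
    let q := QuotientGroup.mk' A
    have hq : Function.Surjective q := QuotientGroup.mk'_surjective _
    have hmap : ∀ i, ((⊤ : Subgroup G).lowerCentralSeries i).map q =
        (⊤ : Subgroup (G ⧸ A)).lowerCentralSeries i := fun i => by
      rw [map_lowerCentralSeries, map_top_of_surjective q hq]
    obtain ⟨Y', hY', hfin⟩ := (Subgroup.fg_iff _).1 (ih (G := G ⧸ A) (S := q '' S) (hS.image q)
      (by rw [← MonoidHom.map_closure, hSG, map_top_of_surjective q hq])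
      (by rw [← hmap, Subgroup.map_eq_bot_iff, QuotientGroup.ker_mk']))
    rw [← hmap] at hY'
    have hsub : Y' ⊆ q '' ((⊤ : Subgroup G).lowerCentralSeries c : Set G) := by
      rw [← coe_map, ← hY']
      exact subset_closure
    obtain ⟨Y, hY, hYfin, rfl⟩ := Set.exists_subset_image_finite_and.1 ⟨Y', hsub, hfin, rfl⟩
    rw [← MonoidHom.map_closure] at hY'
    have := commutator_top_eq_closure ((⊤ : Subgroup G).lowerCentralSeries c) Y S hSG
      (by
        have h1 : (⊤ : Subgroup G).lowerCentralSeries c ≤ comap q (map q (closure Y)) := by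
          rw [hY']; exact le_comap_map _ _
        rw [comap_map_eq, QuotientGroup.ker_mk'] at h1
        exact h1.trans (sup_le_sup_left hA _)) hY hA
    exact (Subgroup.fg_iff _).2 ⟨_, this.symm, hYfin.image2 _ hS⟩

theorem exists_hasCyclicCentralSeries_of_lowerCentralSeries (c : ℕ) {G : Type u} [Group G]
    {S : Set G} (hS : S.Finite) (hSG : closure S = ⊤)
    (h : (⊤ : Subgroup G).lowerCentralSeries c = ⊥) : ∃ d, HasCyclicCentralSeries d G := by
  induction c generalizing G with
  | zero => exact ⟨0, Subgroup.subsingleton_iff.1 (subsingleton_of_bot_eq_top h.symm)⟩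
  | succ c ih =>
    set A := (⊤ : Subgroup G).lowerCentralSeries c with hAdef
    have hA : A ≤ center G := lowerCentralSeries_le_center h
    let q := QuotientGroup.mk' A
    have hq : Function.Surjective q := QuotientGroup.mk'_surjective _
    obtain ⟨d, hd⟩ := ih (G := G ⧸ A) (S := q '' S) (hS.image q)
      (by rw [← MonoidHom.map_closure, hSG, map_top_of_surjective q hq])
      (by rw [← map_top_of_surjective q hq, ← map_lowerCentralSeries, Subgroup.map_eq_bot_iff,
        QuotientGroup.ker_mk'])
    obtain ⟨T, hT⟩ := fg_lowerCentralSeries c hS hSG h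
    exact hasCyclicCentralSeries_of_central_ker T hd q hq id
      (fun i hi => hA (show i ∈ A by rw [hAdef, ← hT]; exact subset_closure hi))
      (by rw [QuotientGroup.ker_mk', Set.image_id, hT])

theorem exists_hasCyclicCentralSeries {G : Type u} [Group G] [Group.IsNilpotent G] {S : Set G}
    (hS : S.Finite) (hSG : closure S = ⊤) : ∃ d, HasCyclicCentralSeries d G := by
  obtain ⟨c, hc⟩ := (Subgroup.nilpotent_iff_lowerCentralSeries (G := G)).1 ‹_›
  exact exists_hasCyclicCentralSeries_of_lowerCentralSeries c hS hSG hc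

theorem relIndex_zpowers_le {N : Type*} [Group N] (L : Subgroup N) (z : N) {M : ℕ} (hM : 0 < M)
    (hz : z ^ M ∈ L) : L.relIndex (zpowers z) ≠ 0 ∧ L.relIndex (zpowers z) ≤ M := by
  let F : Fin M → zpowers z ⧸ L.subgroupOf (zpowers z) := fun i =>
    QuotientGroup.mk ⟨z ^ (i : ℕ), pow_mem (mem_zpowers z) _⟩
  have hF : Function.Surjective F := by
    intro y
    obtain ⟨⟨_, k, rfl⟩, rfl⟩ := QuotientGroup.mk_surjective y
    have h0 : 0 ≤ k % M := Int.emod_nonneg _ (by omega)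
    have h1 : k % M < M := Int.emod_lt_of_pos _ (by omega)
    refine ⟨⟨(k % M).toNat, by omega⟩, QuotientGroup.eq.2 ?_⟩
    rw [mem_subgroupOf]
    have h2 : z ^ (k % M).toNat = z ^ (k % M) := by rw [← zpow_natCast, Int.toNat_of_nonneg h0]
    have h3 : (z ^ (k % M).toNat)⁻¹ * z ^ k = (z ^ M) ^ (k / M) := by
      rw [h2, ← zpow_neg, ← zpow_add, ← zpow_natCast, ← zpow_mul]
      congr 1
      linarith [Int.mul_ediv_add_emod k M]
    change (z ^ (k % M).toNat)⁻¹ * z ^ k ∈ L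
    rw [h3]
    exact zpow_mem hz _
  have : Finite (zpowers z ⧸ L.subgroupOf (zpowers z)) := Finite.of_surjective F hF
  refine ⟨?_, ?_⟩
  · exact Nat.card_pos.ne'
  · exact (Nat.card_le_card_of_surjective F hF).trans (by simp)

/-- A normal subgroup containing all `M`-th powers has index at most `M ^ d`. -/
theorem index_le_of_pow_mem (d : ℕ) {N : Type u} [Group N] (h : HasCyclicCentralSeries d N)
    (L : Subgroup N) [L.Normal] {M : ℕ} (hM : 0 < M) (hL : ∀ x : N, x ^ M ∈ L) :
    L.index ≠ 0 ∧ L.index ≤ M ^ d := by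
  induction d generalizing N with
  | zero =>
    have : Subsingleton N := h
    have : L = ⊤ := Subsingleton.elim _ _
    simp [this]
  | succ d ih =>
    obtain ⟨N', _, f, z, hf, hz, hker, h'⟩ := h
    have : (L.map f).Normal := Subgroup.Normal.map ‹_› f hf
    obtain ⟨h0, h1⟩ := ih h' (L.map f) (fun y => by
      obtain ⟨x, rfl⟩ := hf y
      exact ⟨x ^ M, hL x, map_pow f x M⟩)
    rw [index_map, MonoidHom.range_eq_top.2 hf, index_top, mul_one, hker] at h0 h1
    obtain ⟨h2, h3⟩ := relIndex_zpowers_le L z hM (hL z)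
    rw [← relIndex_mul_index (le_sup_left : L ≤ L ⊔ zpowers z), relIndex_sup_left, pow_succ']
    exact ⟨mul_ne_zero h2 h0, Nat.mul_le_mul h3 h1⟩

/-! ### Products of powers in nilpotent groups -/

theorem commutatorElement_pow_left_of_central {G : Type*} [Group G] {u y : G}
    (h : ⁅u, y⁆ ∈ center G) (k : ℕ) : ⁅u ^ k, y⁆ = ⁅u, y⁆ ^ k := by
  induction k with
  | zero => simp
  | succ k ih => rw [pow_succ, commutatorElement_mul_left_of_central h, ih, pow_succ]

theorem mk_mem_center_of_mem_lowerCentralSeries {G : Type*} [Group G] {j : ℕ} {v : G}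
    (hv : v ∈ (⊤ : Subgroup G).lowerCentralSeries j) :
    QuotientGroup.mk' ((⊤ : Subgroup G).lowerCentralSeries (j + 1)) v ∈ center _ := by
  rw [mem_center_iff]
  intro g
  obtain ⟨g, rfl⟩ := QuotientGroup.mk'_surjective _ g
  have : ⁅v, g⁆ ∈ (⊤ : Subgroup G).lowerCentralSeries (j + 1) :=
    commutator_mem_commutator hv (mem_top g)
  rw [← QuotientGroup.ker_mk' ((⊤ : Subgroup G).lowerCentralSeries (j + 1)), MonoidHom.mem_ker,
    map_commutatorElement, commutatorElement_eq_one_iff_mul_comm] at this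
  exact this.symm

theorem commutatorElement_pow_mem_lowerCentralSeries {G : Type*} [Group G] {q : ℕ}
    (hq : ∀ x ∈ commutator G, x ^ q = 1) (j : ℕ) (x y : G) :
    ⁅x ^ q ^ j, y⁆ ∈ (⊤ : Subgroup G).lowerCentralSeries (j + 1) := by
  induction j with
  | zero => exact commutator_mem_commutator (mem_top _) (mem_top _)
  | succ j ih =>
    have hc := mk_mem_center_of_mem_lowerCentralSeries ih
    rw [map_commutatorElement] at hc
    have h := commutatorElement_pow_left_of_central hc q
    rw [← map_pow, ← map_commutatorElement, ← map_commutatorElement, ← map_pow,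
      hq ⁅x ^ q ^ j, y⁆ (commutator_mem_commutator (mem_top _) (mem_top _)), map_one,
      ← MonoidHom.mem_ker, QuotientGroup.ker_mk', ← pow_mul, ← pow_succ] at h
    exact h

theorem mul_pow_of_commutator_pow_eq_one {G : Type*} [Group G] {q c : ℕ}
    (hq : ∀ x ∈ commutator G, x ^ q = 1) (hc : (⊤ : Subgroup G).lowerCentralSeries c = ⊥)
    (x y : G) : (x * y) ^ q ^ (c + 1) = x ^ q ^ (c + 1) * y ^ q ^ (c + 1) := by
  have hcen : ∀ x g : G, Commute (x ^ q ^ c) g := by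
    intro x g
    have h := Subgroup.lowerCentralSeries_antitone _ c.le_succ
      (commutatorElement_pow_mem_lowerCentralSeries hq c x g)
    rwa [hc, mem_bot, commutatorElement_eq_one_iff_commute] at h
  set t := (x ^ q ^ c * y ^ q ^ c)⁻¹ * (x * y) ^ q ^ c with ht
  have htq : t ^ q = 1 := by
    apply hq
    rw [← Abelianization.ker_of, MonoidHom.mem_ker, ht]
    simp [mul_pow]
  have hxy : (x * y) ^ q ^ c = x ^ q ^ c * (y ^ q ^ c * t) := by rw [ht]; group
  rw [pow_succ, pow_mul, pow_mul, pow_mul, hxy, (hcen x _).mul_pow, (hcen y _).mul_pow, htq,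
    mul_one]

theorem lowerCentralSeries_zpowers_sup_commutator_le {G : Type*} [Group G] (y : G) (c : ℕ) :
    (zpowers y ⊔ commutator G).lowerCentralSeries (c + 1) ≤
      (⊤ : Subgroup G).lowerCentralSeries (c + 2) := by
  induction c with
  | zero =>
    rw [Subgroup.lowerCentralSeries_succ, Subgroup.lowerCentralSeries_zero, commutator_le]
    have key : ∀ h ∈ zpowers y ⊔ commutator G, ∃ k : ℤ, ∃ z ∈ center _,
        QuotientGroup.mk' ((⊤ : Subgroup G).lowerCentralSeries 2) h =
          QuotientGroup.mk' ((⊤ : Subgroup G).lowerCentralSeries 2) y ^ k * z := by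
      intro h hh
      obtain ⟨_, ⟨k, rfl⟩, a, ha, rfl⟩ := mem_sup_of_normal_right.1 hh
      exact ⟨k, _, mk_mem_center_of_mem_lowerCentralSeries (j := 1) ha, by
        rw [← map_zpow, ← map_mul]⟩
    intro g hg h hh
    rw [← QuotientGroup.ker_mk' ((⊤ : Subgroup G).lowerCentralSeries (0 + 2)), MonoidHom.mem_ker,
      map_commutatorElement, commutatorElement_eq_one_iff_commute]
    obtain ⟨k, z, hz, hk⟩ := key g hg
    obtain ⟨l, w, hw, hl⟩ := key h hh
    rw [hk, hl]
    have hz' : ∀ g, Commute z g := fun g => (mem_center_iff.1 hz g).symm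
    have hw' : ∀ g, Commute g w := fun g => mem_center_iff.1 hw g
    exact ((((Commute.refl _).zpow_zpow k l).mul_right (hw' _))).mul_left (hz' _)
  | succ c ih => exact commutator_mono ih le_top

/-- In a nilpotent group of bounded class, a product of `m ^ e`-th powers is an `m`-th power. -/
theorem exists_pow_eq_of_mem_closure_pow_aux (c : ℕ) : ∃ e : ℕ, ∀ (m : ℕ) (G : Type u) [Group G],
    (⊤ : Subgroup G).lowerCentralSeries (c + 1) = ⊥ →
      ∀ u ∈ closure (Set.range fun x : G => x ^ m ^ e), ∃ y, y ^ m = u := by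
  induction c with
  | zero =>
    refine ⟨1, fun m G _ hG u hu => ?_⟩
    have hcomm : ∀ x y : G, Commute x y := fun x y => by
      have : ⁅x, y⁆ ∈ (⊤ : Subgroup G).lowerCentralSeries (0 + 1) :=
        commutator_mem_commutator (mem_top _) (mem_top _)
      rwa [hG, mem_bot, commutatorElement_eq_one_iff_commute] at this
    induction hu using closure_induction with
    | mem x hx =>
      obtain ⟨y, rfl⟩ := hx
      exact ⟨y, by simp⟩
    | one => exact ⟨1, one_pow m⟩
    | mul a b _ _ ha hb =>
      obtain ⟨⟨a, rfl⟩, b, rfl⟩ := And.intro ha hb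
      exact ⟨a * b, (hcomm a b).mul_pow m⟩
    | inv a _ ha =>
      obtain ⟨a, rfl⟩ := ha
      exact ⟨a⁻¹, inv_pow a m⟩
  | succ c ih =>
    obtain ⟨e, he⟩ := ih
    refine ⟨e * (c + 3), fun m G _ hG u hu => ?_⟩
    rw [pow_mul] at hu
    set q := m ^ e
    let W : Subgroup G := closure ((fun x => x ^ q) '' (commutator G : Set G))
    have hW : W.Normal := by
      refine ⟨fun n hn g => ?_⟩
      have h1 : W.map (MulAut.conj g).toMonoidHom ≤ W := by
        rw [MonoidHom.map_closure, closure_le]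
        rintro _ ⟨_, ⟨x, hx, rfl⟩, rfl⟩
        refine subset_closure ⟨g * x * g⁻¹, (inferInstance : (commutator G).Normal).conj_mem x hx g,
          ?_⟩
        simp
      exact h1 ⟨n, hn, by simp⟩
    let p := QuotientGroup.mk' W
    have hp : Function.Surjective p := QuotientGroup.mk'_surjective W
    have hmul := mul_pow_of_commutator_pow_eq_one (G := G ⧸ W) (q := q) (c := c + 2)
      (by
        intro x hx
        rw [commutator_def, ← map_top_of_surjective p hp, ← map_commutator] at hx
        obtain ⟨x, hx, rfl⟩ := hx
        rw [← map_pow, ← MonoidHom.mem_ker, QuotientGroup.ker_mk']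
        exact subset_closure ⟨x, hx, rfl⟩)
      (by rw [← map_top_of_surjective p hp, ← map_lowerCentralSeries, hG, Subgroup.map_bot])
    let φ : G ⧸ W →* G ⧸ W := MonoidHom.mk' (fun x => x ^ q ^ (c + 2 + 1)) hmul
    have hu' : p u ∈ φ.range := by
      have : closure (Set.range fun x : G => x ^ q ^ (c + 3)) ≤ φ.range.comap p := by
        rw [closure_le]
        rintro _ ⟨x, rfl⟩
        exact ⟨p x, (map_pow p x _).symm⟩
      exact this hu
    obtain ⟨y, hy⟩ := hu'
    obtain ⟨y, rfl⟩ := hp y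
    let H : Subgroup G := zpowers y ⊔ commutator G
    have hyH : y ∈ H := mem_sup_left (mem_zpowers y)
    have hw : (y ^ q ^ (c + 2 + 1))⁻¹ * u ∈ W := by
      rw [← QuotientGroup.ker_mk' W, MonoidHom.mem_ker, map_mul, map_inv, inv_mul_eq_one, map_pow]
      exact hy
    have hHbot : (⊤ : Subgroup H).lowerCentralSeries (c + 1) = ⊥ := by
      apply map_injective H.subtype_injective
      rw [top_subtype_lowerCentralSeries, Subgroup.map_bot, eq_bot_iff, ← hG]
      exact lowerCentralSeries_zpowers_sup_commutator_le y c
    let D : Subgroup H := closure (Set.range fun x : H => x ^ m ^ e)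
    have hWD : W ≤ D.map H.subtype := by
      rw [closure_le]
      rintro _ ⟨x, hx, rfl⟩
      exact ⟨⟨x, mem_sup_right hx⟩ ^ q, subset_closure ⟨_, rfl⟩, rfl⟩
    have hyD : y ^ q ^ (c + 2 + 1) ∈ D.map H.subtype :=
      ⟨(⟨y, hyH⟩ ^ q ^ (c + 2)) ^ q, subset_closure ⟨_, rfl⟩, by
        rw [← pow_mul, ← pow_succ]; rfl⟩
    obtain ⟨u', hu', hu''⟩ : u ∈ D.map H.subtype := by
      have := mul_mem hyD (hWD hw)
      rwa [mul_inv_cancel_left] at this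
    obtain ⟨z, hz⟩ := he m H hHbot u' hu'
    exact ⟨z, by rw [← hu'', ← hz]; rfl⟩

theorem exists_pow_eq_of_mem_closure_pow (G : Type u) [Group G] [Group.IsNilpotent G] :
    ∃ e : ℕ, ∀ m : ℕ, ∀ u ∈ closure (Set.range fun x : G => x ^ m ^ e), ∃ y, y ^ m = u := by
  obtain ⟨c, hc⟩ := (Subgroup.nilpotent_iff_lowerCentralSeries (G := G)).1 ‹_›
  obtain ⟨e, he⟩ := exists_pow_eq_of_mem_closure_pow_aux.{u} c
  refine ⟨e, fun m => he m G ?_⟩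
  rw [eq_bot_iff, ← hc]
  exact Subgroup.lowerCentralSeries_antitone _ c.le_succ

/-! ### Distortion -/

theorem exists_forall_of_finite {α : Type*} {A : Set α} (hA : A.Finite) {P : α → ℕ → Prop}
    (hP : ∀ a k l, k ≤ l → P a k → P a l) (h : ∀ a ∈ A, ∃ k, P a k) : ∃ k, ∀ a ∈ A, P a k := by
  choose! g hg using h
  refine ⟨hA.toFinset.sup g, fun a ha => hP a _ _ (Finset.le_sup (f := g) ?_) (hg a ha)⟩
  simpa using ha

theorem exists_conj_pow_mem_wordBall {G : Type*} [Group G] [Group.IsNilpotent G] {K : Subgroup G}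
    [K.Normal] {T : Set G} (hT : closure T = K) (t : G) {n : G} (hn : n ∈ K) :
    ∃ k : ℕ, ∀ e : ℕ, (t ^ e)⁻¹ * n * t ^ e ∈ wordBall T ((e + 2) ^ k) := by
  obtain ⟨c, hc⟩ := (Subgroup.nilpotent_iff_lowerCentralSeries (G := G)).1 ‹_›
  have key : ∀ i j, i + j = c → ∀ n ∈ K, n ∈ (⊤ : Subgroup G).lowerCentralSeries j →
      ∃ k : ℕ, ∀ e : ℕ, (t ^ e)⁻¹ * n * t ^ e ∈ wordBall T ((e + 2) ^ k) := by
    intro i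
    induction i with
    | zero =>
      intro j hj n _ hn
      obtain rfl : j = c := by omega
      rw [hc, mem_bot] at hn
      exact ⟨0, fun e => by simpa [hn] using one_mem_wordBall⟩
    | succ i ih =>
      intro j hj n hn hn'
      have hu : ⁅n⁻¹, t⁻¹⁆ = n⁻¹ * (t⁻¹ * n * t) := by rw [commutatorElement_def]; group
      obtain ⟨k, hk⟩ := ih (j + 1) (by omega) ⁅n⁻¹, t⁻¹⁆
        (by
          rw [hu]
          have := (inferInstance : K.Normal).conj_mem n hn t⁻¹
          rw [inv_inv] at this
          exact mul_mem (inv_mem hn) this)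
        (commutator_mem_commutator (inv_mem hn') (mem_top _))
      obtain ⟨a, ha⟩ := exists_mem_wordBall (hT ▸ hn : n ∈ closure T)
      have hF : ∀ e : ℕ, (t ^ e)⁻¹ * n * t ^ e ∈ wordBall T (a + e * (e + 2) ^ k) := by
        intro e
        induction e with
        | zero => simpa using ha
        | succ e ihe =>
          have h := mul_mem_wordBall ihe (hk e)
          rw [show (t ^ e)⁻¹ * n * t ^ e * ((t ^ e)⁻¹ * ⁅n⁻¹, t⁻¹⁆ * t ^ e) =
            (t ^ (e + 1))⁻¹ * n * t ^ (e + 1) by rw [hu, pow_succ']; group] at h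
          refine wordBall_mono ?_ h
          have h2 : (e + 2) ^ k ≤ (e + 1 + 2) ^ k := Nat.pow_le_pow_left (by omega) k
          nlinarith
      obtain ⟨k', hk'⟩ := (PolyBound.const a).add (PolyBound.id.mul (polyBound_pow k))
      exact ⟨k', fun e => wordBall_mono (hk' e) (hF e)⟩
  exact key c 0 (by omega) n hn (mem_top n)

theorem exists_conj_zpow_mem_wordBall {G : Type*} [Group G] [Group.IsNilpotent G] {K : Subgroup G}
    [K.Normal] {T : Set G} (hT : closure T = K) (t : G) {n : G} (hn : n ∈ K) :
    ∃ k : ℕ, ∀ e : ℤ, (t ^ e)⁻¹ * n * t ^ e ∈ wordBall T ((e.natAbs + 2) ^ k) := by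
  obtain ⟨k, hk⟩ := exists_conj_pow_mem_wordBall hT t hn
  obtain ⟨l, hl⟩ := exists_conj_pow_mem_wordBall hT t⁻¹ hn
  refine ⟨k + l, fun e => ?_⟩
  rcases Int.natAbs_eq e with h | h
  · have := hk e.natAbs
    rw [← zpow_natCast, ← h] at this
    exact wordBall_mono (Nat.pow_le_pow_right (by omega) (by omega)) this
  · have := hl e.natAbs
    rw [inv_pow, ← zpow_natCast, ← zpow_neg, ← h] at this
    exact wordBall_mono (Nat.pow_le_pow_right (by omega) (by omega)) this

theorem exists_zpow_mem_wordBall {G : Type*} [Group G] {K : Subgroup G} {T : Set G}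
    (hT : closure T = K) (t : G) :
    ∃ c : ℕ, ∀ e : ℤ, t ^ e ∈ K → t ^ e ∈ wordBall T (e.natAbs * c) := by
  let A : AddSubgroup ℤ :=
    { carrier := {e | t ^ e ∈ K}
      zero_mem' := by simp
      add_mem' := fun {a b} ha hb => by
        simpa only [Set.mem_ofPred_eq, zpow_add] using mul_mem ha hb
      neg_mem' := fun {a} ha => by simpa only [Set.mem_ofPred_eq, zpow_neg] using inv_mem ha }
  obtain ⟨q, hq⟩ := Int.subgroup_cyclic A
  have hqA : t ^ q ∈ K := by
    have : q ∈ A := hq ▸ AddSubgroup.subset_closure rfl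
    exact this
  obtain ⟨c, hc⟩ := exists_mem_wordBall (hT ▸ hqA : t ^ q ∈ closure T)
  refine ⟨c, fun e he => ?_⟩
  have he' : e ∈ A := he
  rw [hq, AddSubgroup.mem_closure_singleton] at he'
  obtain ⟨n, hn⟩ := he'
  rw [smul_eq_mul] at hn
  by_cases hq0 : q = 0
  · rw [← hn, hq0, mul_zero, zpow_zero]
    exact one_mem_wordBall
  · have h := zpow_mem_wordBall hc n
    rw [← zpow_mul, mul_comm q n, hn] at h
    refine wordBall_mono (Nat.mul_le_mul_right c ?_) h
    rw [← hn, Int.natAbs_mul]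
    exact Nat.le_mul_of_pos_right _ (Int.natAbs_pos.2 hq0)

/-- In a nilpotent group, a normal subgroup with cyclic quotient is polynomially embedded. -/
theorem exists_polyBound_of_cyclic_extension {G : Type*} [Group G] [Group.IsNilpotent G]
    {K : Subgroup G} [K.Normal] {T U : Set G} (hT : closure T = K) (hU : U.Finite) (t : G)
    (h : ∀ u ∈ closure U, ∃ (e : ℤ) (y : G), y ∈ K ∧ u = t ^ e * y) :
    ∃ f, PolyBound f ∧ ∀ r, ∀ x ∈ K, x ∈ wordBall U r → x ∈ wordBall T (f r) := by
  obtain ⟨c, hc⟩ := exists_zpow_mem_wordBall hT t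
  obtain ⟨k, hk⟩ := exists_forall_of_finite (A := U ∪ U⁻¹) (hU.union hU.inv)
    (P := fun u k => ∃ (ε : ℤ) (n : G), n ∈ K ∧ u = t ^ ε * n ∧ ε.natAbs ≤ k ∧
      ∀ e : ℤ, (t ^ e)⁻¹ * n * t ^ e ∈ wordBall T ((e.natAbs + 2) ^ k))
    (by
      rintro u k l hkl ⟨ε, n, hn, hu, hε, hw⟩
      exact ⟨ε, n, hn, hu, hε.trans hkl, fun e =>
        wordBall_mono (Nat.pow_le_pow_right (by omega) hkl) (hw e)⟩)
    (by
      intro u hu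
      have hu' : u ∈ closure U := by
        rcases hu with hu | hu
        · exact subset_closure hu
        · simpa using inv_mem (subset_closure (Set.mem_inv.1 hu) : u⁻¹ ∈ closure U)
      obtain ⟨ε, n, hn, rfl⟩ := h u hu'
      obtain ⟨k, hk⟩ := exists_conj_zpow_mem_wordBall hT t hn
      exact ⟨ε.natAbs + k, ε, n, hn, rfl, by omega, fun e =>
        wordBall_mono (Nat.pow_le_pow_right (by omega) (by omega)) (hk e)⟩)
  have key : ∀ r, ∀ x ∈ wordBall U r, ∃ (e : ℤ) (y : G), x = t ^ e * y ∧ e.natAbs ≤ k * r ∧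
      y ∈ wordBall T (r * (k * r + 2) ^ k) := by
    intro r x hx
    refine wordBall_induction (motive := fun r x => ∃ (e : ℤ) (y : G), x = t ^ e * y ∧
      e.natAbs ≤ k * r ∧ y ∈ wordBall T (r * (k * r + 2) ^ k)) (fun r => ?_)
      (fun r s x hs _ ih => ?_) hx
    · exact ⟨0, 1, by simp, by simp, one_mem_wordBall⟩
    · obtain ⟨e, y, rfl, he, hy⟩ := ih
      obtain ⟨ε, n, -, rfl, hε, hn⟩ := hk s (by simpa using hs)
      refine ⟨ε + e, ((t ^ e)⁻¹ * n * t ^ e) * y, by group, ?_, ?_⟩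
      · have := Int.natAbs_add_le ε e
        rw [mul_add, mul_one]
        omega
      · have h1 : (e.natAbs + 2) ^ k ≤ (k * (r + 1) + 2) ^ k :=
          Nat.pow_le_pow_left (by rw [mul_add]; omega) k
        have h2 : (k * r + 2) ^ k ≤ (k * (r + 1) + 2) ^ k :=
          Nat.pow_le_pow_left (by rw [mul_add]; omega) k
        refine wordBall_mono ?_ (mul_mem_wordBall (hn e) hy)
        rw [Nat.succ_mul, Nat.add_comm]
        exact add_le_add (Nat.mul_le_mul_left r h2) h1
  refine ⟨fun r => k * r * c + r * (k * r + 2) ^ k, ?_, fun r x hxK hx => ?_⟩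
  · exact (((PolyBound.const k).mul PolyBound.id).mul (PolyBound.const c)).add
      (PolyBound.id.mul ((((PolyBound.const k).mul PolyBound.id).add (PolyBound.const 2)).pow k))
  · obtain ⟨e, y, rfl, he, hy⟩ := key r x hx
    have hyK : y ∈ K := hT ▸ wordBall_subset_closure hy
    have := hc e ((mul_mem_cancel_right hyK).1 hxK)
    exact mul_mem_wordBall (wordBall_mono (Nat.mul_le_mul_right c he) this) hy

theorem exists_polyBound_ker (d : ℕ) {N N' : Type u} [Group N] [Group N'] [Group.IsNilpotent N]
    (h : HasCyclicCentralSeries d N') {S : Set N} (hS : S.Finite)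
    (f : N →* N') (hf : Function.Surjective f) {T : Set N} (hT : T.Finite)
    (hTf : closure T = f.ker) :
    ∃ g, PolyBound g ∧ ∀ r, ∀ x ∈ f.ker, x ∈ wordBall S r → x ∈ wordBall T (g r) := by
  induction d generalizing N' T with
  | zero =>
    have hN' : Subsingleton N' := h
    have hker : f.ker = ⊤ := by
      ext x
      simpa using Subsingleton.elim _ _
    obtain ⟨c, hc⟩ := exists_forall_of_finite hS (P := fun s c => s ∈ wordBall T c)
      (fun s k l hkl => wordBall_mono hkl)
      (fun s _ => exists_mem_wordBall (by rw [hTf, hker]; exact mem_top s))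
    exact ⟨fun r => r * c, PolyBound.id.mul (PolyBound.const c), fun r x _ hx =>
      wordBall_trans hc hx⟩
  | succ d ih =>
    obtain ⟨N'', _, f', z', hf', -, hker, h'⟩ := h
    obtain ⟨t, rfl⟩ := hf z'
    have hdec : ∀ u ∈ (f'.comp f).ker, ∃ (e : ℤ) (y : N), y ∈ f.ker ∧ u = t ^ e * y := by
      intro u hu
      have : f u ∈ f'.ker := hu
      rw [hker] at this
      obtain ⟨e, he⟩ := this
      refine ⟨e, (t ^ e)⁻¹ * u, ?_, by group⟩
      rw [MonoidHom.mem_ker, map_mul, map_inv, map_zpow, inv_mul_eq_one]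
      exact he
    have hU : closure (insert t T) = (f'.comp f).ker := by
      have htk : t ∈ (f'.comp f).ker := by
        have : f t ∈ f'.ker := hker ▸ mem_zpowers _
        exact this
      have hle : f.ker ≤ (f'.comp f).ker := by
        rw [← MonoidHom.comap_ker]
        exact (MonoidHom.comap_bot f).symm.le.trans (comap_mono bot_le)
      apply le_antisymm
      · rw [closure_le, Set.insert_subset_iff]
        exact ⟨htk, fun x hx => hle (hTf ▸ subset_closure hx)⟩
      · intro u hu
        obtain ⟨e, y, hy, rfl⟩ := hdec u hu
        refine mul_mem (zpow_mem (subset_closure (Set.mem_insert _ _)) e) ?_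
        exact closure_mono (Set.subset_insert t T) (hTf ▸ hy)
    obtain ⟨g, hg, hgr⟩ := ih h' (f'.comp f) (hf'.comp hf) (hT.insert t) hU
    obtain ⟨g', hg', hgr'⟩ := exists_polyBound_of_cyclic_extension hTf (hT.insert t) t
      (by rw [hU]; exact hdec)
    refine ⟨fun r => g' (g r), hg'.comp hg, fun r x hx hxr => hgr' _ x hx (hgr r x ?_ hxr)⟩
    rw [MonoidHom.mem_ker] at hx ⊢
    rw [MonoidHom.comp_apply, hx, map_one]

theorem exists_zpow_eq_of_mem_wordBall_singleton {G : Type*} [Group G] {z u : G} {r : ℕ}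
    (hu : u ∈ wordBall {z} r) : ∃ a : ℤ, a.natAbs ≤ r ∧ z ^ a = u := by
  refine wordBall_induction (motive := fun r u => ∃ a : ℤ, a.natAbs ≤ r ∧ z ^ a = u)
    (fun r => ⟨0, by simp, by simp⟩) (fun r x u hx _ ih => ?_) hu
  obtain ⟨a, ha, rfl⟩ := ih
  rcases hx with hx | hx
  · exact ⟨1 + a, by omega, by rw [zpow_add, zpow_one, Set.mem_singleton_iff.1 hx]⟩
  · refine ⟨-1 + a, by omega, ?_⟩
    rw [zpow_add, zpow_neg_one, ← Set.mem_singleton_iff.1 hx, inv_inv]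

/-- A central cyclic kernel is polynomially embedded. -/
theorem exists_zpow_eq_of_mem_wordBall {d : ℕ} {N N' : Type u} [Group N] [Group N']
    [Group.IsNilpotent N] (h : HasCyclicCentralSeries d N') {S : Set N} (hS : S.Finite)
    (f : N →* N') (hf : Function.Surjective f) {z : N}
    (hz : f.ker = zpowers z) :
    ∃ k : ℕ, ∀ r, ∀ u ∈ f.ker, u ∈ wordBall S r → ∃ a : ℤ, a.natAbs ≤ (r + 2) ^ k ∧ z ^ a = u := by
  obtain ⟨g, ⟨k, hk⟩, hg⟩ := exists_polyBound_ker d h hS f hf (Set.finite_singleton z)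
    (by rw [hz, zpowers_eq_closure])
  refine ⟨k, fun r u hu hur => ?_⟩
  obtain ⟨a, ha, rfl⟩ := exists_zpow_eq_of_mem_wordBall_singleton (hg r u hu hur)
  exact ⟨a, ha.trans (hk r), rfl⟩

/-! ### Short presentations of subgroups -/

theorem exists_zpow_mul_prod_of_mem_closure {C ι : Type*} [CommGroup C] [Fintype ι] (c : ι → C)
    {b : C} {q : ℕ} (hq : 0 < q) (h : ∀ i, ∃ s : ℤ, c i ^ q = b ^ s) {u : C}
    (hu : u ∈ closure (Set.range c)) :
    ∃ (s : ℤ) (ρ : ι → ℕ), (∀ i, ρ i < q) ∧ u = b ^ s * ∏ i, c i ^ ρ i := by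
  obtain ⟨e, rfl⟩ := exists_of_mem_closure_range c u hu
  have hnn : ∀ i, 0 ≤ e i % q := fun i => Int.emod_nonneg _ (by omega)
  have hb : ∏ i, (c i ^ q) ^ (e i / q) ∈ zpowers b := prod_mem fun i _ => by
    obtain ⟨s, hs⟩ := h i
    rw [hs]
    exact zpow_mem (zpow_mem (mem_zpowers b) s) _
  obtain ⟨s, hs⟩ := hb
  refine ⟨s, fun i => (e i % q).toNat, fun i => ?_, ?_⟩
  · have : e i % q < q := Int.emod_lt_of_pos _ (by omega)
    exact (Int.toNat_lt (hnn i)).2 this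
  · change b ^ s = _ at hs
    rw [hs, ← Finset.prod_mul_distrib]
    refine Finset.prod_congr rfl fun i _ => ?_
    rw [← zpow_natCast, ← zpow_natCast, Int.toNat_of_nonneg (hnn i), ← zpow_mul, ← zpow_add,
      Int.mul_ediv_add_emod]

theorem exists_zpow_mul_prod_of_mem_normalClosure {G ι : Type*} [Group G] [Fintype ι]
    (c : ι → G) (hc : ∀ i, c i ∈ center G) {b : G} (hb : b ∈ center G) {q : ℕ} (hq : 0 < q)
    (h : ∀ i, ∃ s : ℤ, c i ^ q = b ^ s) {u : G} (hu : u ∈ normalClosure (Set.range c)) :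
    ∃ (s : ℤ) (ρ : ι → ℕ), (∀ i, ρ i < q) ∧
      u = b ^ s * ((Finset.univ : Finset ι).toList.map fun i => c i ^ ρ i).prod := by
  let _ : CommGroup (center G) :=
    { (inferInstance : Group (center G)) with
      mul_comm := fun x y => Subtype.ext (mem_center_iff.1 y.2 x) }
  let c' : ι → center G := fun i => ⟨c i, hc i⟩
  have hle : normalClosure (Set.range c) ≤ (closure (Set.range c')).map (center G).subtype := by
    have hnorm : ((closure (Set.range c')).map (center G).subtype).Normal := by
      refine ⟨fun n hn g => ?_⟩
      have : n ∈ center G := by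
        obtain ⟨n, -, rfl⟩ := hn
        exact n.2
      rwa [mem_center_iff.1 this g, mul_inv_cancel_right]
    refine normalClosure_le_normal ?_
    rintro _ ⟨i, rfl⟩
    exact ⟨c' i, subset_closure ⟨i, rfl⟩, rfl⟩
  obtain ⟨u', hu', rfl⟩ := hle hu
  obtain ⟨s, ρ, hρ, rfl⟩ := exists_zpow_mul_prod_of_mem_closure c' (b := ⟨b, hb⟩) hq
    (fun i => by
      obtain ⟨s, hs⟩ := h i
      exact ⟨s, Subtype.ext hs⟩) hu'
  refine ⟨s, ρ, hρ, ?_⟩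
  rw [map_mul, map_zpow, ← Finset.prod_map_toList, map_list_prod, List.map_map]
  rfl

theorem list_prod_mem_wordBall {G : Type*} [Group G] {X : Set G} {r : ℕ} (l : List G)
    (h : ∀ g ∈ l, g ∈ wordBall X r) : l.prod ∈ wordBall X (l.length * r) := by
  induction l with
  | nil => exact one_mem_wordBall
  | cons g l ih =>
    rw [List.prod_cons, List.length_cons, Nat.succ_mul, Nat.add_comm]
    exact mul_mem_wordBall (h g List.mem_cons_self)
      (ih fun g hg => h g (List.mem_cons_of_mem _ hg))

/-- The elements of the kernel of `Φ` which are represented by words of length at most `R`. -/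
def shortKer {F N : Type*} [Group F] [Group N] (Φ : F →* N) (X : Set F) (R : ℕ) : Set F :=
  {w | w ∈ Φ.ker ∧ w ∈ wordBall X R}

theorem mem_normalClosure_shortKer {F N : Type*} [Group F] [Group N] {Φ : F →* N} {X V : Set F}
    (hX : closure X = ⊤) {R A Q B R' : ℕ} {z : N} (hVR : ∀ w ∈ V, w ∈ wordBall X R)
    (hV1 : 1 ∈ V) (hVz : ∀ w ∈ V, ∃ a : ℤ, a.natAbs ≤ A ∧ z ^ a = Φ w) (hz : z ∈ center N)
    {b : F} (hb : b ∈ V) {q : ℕ} (hq : 0 < q) (hqQ : q ≤ Q)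
    (hVq : ∀ w ∈ V, ∃ s : ℤ, s.natAbs ≤ A ∧ Φ w ^ q = Φ b ^ s)
    (hbs : ∀ (s : ℤ) (v : F), v ∈ wordBall X ((2 * A + 1) * (Q * R)) → Φ (b ^ s * v) = 1 →
      ∃ s' : ℤ, s'.natAbs ≤ B ∧ b ^ s' = b ^ s)
    (h1 : 2 * R + 2 ≤ R') (h2 : Q * R + A * R ≤ R') (h3 : B * R + (2 * A + 1) * (Q * R) ≤ R')
    {u : F} (hu : u ∈ Φ.ker) (huV : u ∈ normalClosure V) :
    u ∈ normalClosure (shortKer Φ X R') := by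
  set M := normalClosure (shortKer Φ X R')
  have hMK : M ≤ Φ.ker := normalClosure_le_normal fun w hw => hw.1
  let p := QuotientGroup.mk' M
  have hp : Function.Surjective p := QuotientGroup.mk'_surjective M
  have hpM : ∀ {w : F}, w ∈ Φ.ker → w ∈ wordBall X R' → p w = 1 := fun hw hw' => by
    rw [← MonoidHom.mem_ker, QuotientGroup.ker_mk']
    exact subset_normalClosure ⟨hw, hw'⟩
  have hpeq : ∀ {v w : F}, Φ v = Φ w → v * w⁻¹ ∈ wordBall X R' → p v = p w := fun hvw h => by
    rw [← mul_inv_eq_one, ← map_inv, ← map_mul]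
    exact hpM (by rw [MonoidHom.mem_ker, map_mul, map_inv, hvw, mul_inv_cancel]) h
  have hcen : ∀ w ∈ V, p w ∈ center (F ⧸ M) := by
    intro w hw
    have hle : closure X ≤ (centralizer {p w}).comap p := by
      rw [closure_le]
      intro x hx
      change p x ∈ centralizer {p w}
      rw [mem_centralizer_singleton_iff, ← map_mul, ← map_mul]
      apply hpeq
      · obtain ⟨a, -, ha⟩ := hVz w hw
        rw [map_mul, map_mul, ← ha]
        exact mem_center_iff.1 (zpow_mem hz a) _
      · have hx1 := mem_wordBall_of_mem hx
        refine wordBall_mono ?_ (mul_mem_wordBall (mul_mem_wordBall hx1 (hVR w hw))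
          (inv_mem_wordBall (mul_mem_wordBall (hVR w hw) hx1)))
        omega
    rw [mem_center_iff]
    intro g
    obtain ⟨g, rfl⟩ := hp g
    have : g ∈ (centralizer {p w}).comap p := hle (hX ▸ mem_top g)
    exact mem_centralizer_singleton_iff.1 this
  let I := Finset.Icc (-(A : ℤ)) A
  have hI : ∀ i : I, ∃ w ∈ V, (∃ w' ∈ V, Φ w' = z ^ (i : ℤ)) → Φ w = z ^ (i : ℤ) := by
    intro i
    by_cases h : ∃ w' ∈ V, Φ w' = z ^ (i : ℤ)
    · obtain ⟨w, hw, hw'⟩ := h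
      exact ⟨w, hw, fun _ => hw'⟩
    · exact ⟨1, hV1, fun h' => absurd h' h⟩
  choose w hwV hw using hI
  have hclosure : normalClosure V ≤ (normalClosure (Set.range fun i => p (w i))).comap p := by
    refine normalClosure_le_normal fun v hv => ?_
    obtain ⟨a, ha, hav⟩ := hVz v hv
    let i : I := ⟨a, Finset.mem_Icc.2 ⟨by omega, by omega⟩⟩
    have hvi : p v = p (w i) := by
      apply hpeq
      · rw [hw i ⟨v, hv, hav.symm⟩, ← hav]
      · refine wordBall_mono ?_ (mul_mem_wordBall (hVR v hv) (inv_mem_wordBall (hVR _ (hwV i))))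
        omega
    rw [SetLike.mem_coe, mem_comap, hvi]
    exact subset_normalClosure ⟨i, rfl⟩
  obtain ⟨s, ρ, hρ, hpu⟩ := exists_zpow_mul_prod_of_mem_normalClosure (fun i => p (w i))
    (fun i => hcen _ (hwV i)) (hcen b hb) hq
    (by
      intro i
      obtain ⟨s, hs, hbs⟩ := hVq _ (hwV i)
      refine ⟨s, ?_⟩
      rw [← map_pow, ← map_zpow]
      apply hpeq
      · rw [map_pow, map_zpow, hbs]
      · refine wordBall_mono ?_ (mul_mem_wordBall (pow_mem_wordBall (hVR _ (hwV i)) q)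
          (inv_mem_wordBall (zpow_mem_wordBall (hVR b hb) s)))
        exact (add_le_add (Nat.mul_le_mul_right R hqQ) (Nat.mul_le_mul_right R hs)).trans h2)
    (hclosure huV)
  set v := ((Finset.univ : Finset I).toList.map fun i => w i ^ ρ i).prod with hv
  have hvball : v ∈ wordBall X ((2 * A + 1) * (Q * R)) := by
    have := list_prod_mem_wordBall (X := X) (r := Q * R)
      ((Finset.univ : Finset I).toList.map fun i => w i ^ ρ i)
      (by
        intro g hg
        obtain ⟨i, -, rfl⟩ := List.mem_map.1 hg
        exact wordBall_mono (Nat.mul_le_mul_right R ((hρ i).le.trans hqQ))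
          (pow_mem_wordBall (hVR _ (hwV i)) (ρ i)))
    refine wordBall_mono (Nat.mul_le_mul_right _ ?_) this
    rw [List.length_map, Finset.length_toList, Finset.card_univ, Fintype.card_coe, Int.card_Icc]
    omega
  have hpv : p u = p (b ^ s * v) := by
    rw [hpu, hv, map_mul, map_zpow, map_list_prod, List.map_map]
    congr 2
  have hker : Φ (b ^ s * v) = 1 := by
    have : u⁻¹ * (b ^ s * v) ∈ Φ.ker := hMK (QuotientGroup.eq.1 hpv)
    simpa using (mul_mem_cancel_left (inv_mem hu)).1 this
  obtain ⟨s', hs', hbs'⟩ := hbs s v hvball hker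
  rw [← QuotientGroup.ker_mk' M, MonoidHom.mem_ker]
  change p u = 1
  rw [hpv, ← hbs']
  apply hpM
  · rw [MonoidHom.mem_ker, hbs', hker]
  · exact wordBall_mono ((Nat.add_le_add_right (Nat.mul_le_mul_right R hs') _).trans h3)
      (mul_mem_wordBall (zpow_mem_wordBall (hVR b hb) s') hvball)

theorem lift_mem_wordBall {N : Type*} [Group N] {S : Set N} {ι : Type*} {x : ι → N} {n r : ℕ}
    (hx : ∀ i, x i ∈ wordBall S n) {w : FreeGroup ι}
    (hw : w ∈ wordBall (Set.range FreeGroup.of) r) :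
    FreeGroup.lift x w ∈ wordBall S (r * n) := by
  refine wordBall_trans ?_ (map_mem_wordBall (FreeGroup.lift x) hw)
  rintro _ ⟨_, ⟨i, rfl⟩, rfl⟩
  rw [FreeGroup.lift_apply_of]
  exact hx i

theorem lift_comp_eq {N N' : Type*} [Group N] [Group N'] (f : N →* N') {ι : Type*} (x : ι → N) :
    FreeGroup.lift (fun i => f (x i)) = f.comp (FreeGroup.lift x) :=
  FreeGroup.ext_hom _ _ fun i => by simp

/-- The subgroups of a nilpotent group generated by elements of the ball of radius `n` have
presentations whose relators are of polynomially bounded length. -/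
theorem exists_ker_lift_le_normalClosure (d : ℕ) {N : Type u} [Group N] [Group.IsNilpotent N]
    (h : HasCyclicCentralSeries d N) {S : Set N} (hS : S.Finite) :
    ∃ k : ℕ, ∀ (n : ℕ) (ι : Type v) (x : ι → N), (∀ i, x i ∈ wordBall S n) →
      (FreeGroup.lift x).ker ≤
        normalClosure (shortKer (FreeGroup.lift x) (Set.range FreeGroup.of) ((n + 2) ^ k)) := by
  induction d generalizing N with
  | zero =>
    have hN : Subsingleton N := h
    refine ⟨0, fun n ι x _ => ?_⟩
    have hle : closure (Set.range FreeGroup.of) ≤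
        normalClosure (shortKer (FreeGroup.lift x) (Set.range FreeGroup.of) ((n + 2) ^ 0)) := by
      rw [closure_le]
      rintro _ ⟨i, rfl⟩
      exact subset_normalClosure ⟨Subsingleton.elim _ _, mem_wordBall_of_mem ⟨i, rfl⟩⟩
    rw [FreeGroup.closure_range_of] at hle
    exact le_top.trans hle
  | succ d ih =>
    obtain ⟨N', _, f, z, hf, hz, hker, h'⟩ := h
    have : Group.IsNilpotent N' := Group.nilpotent_of_surjective f hf
    obtain ⟨k₀, hk₀⟩ := ih h' (hS.image f)
    obtain ⟨k₁, hk₁⟩ := exists_zpow_eq_of_mem_wordBall h' hS f hf hker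
    let R : ℕ → ℕ := fun n => (n + 2) ^ k₀
    let A : ℕ → ℕ := fun n => (R n * n + 2) ^ k₁
    let Q : ℕ → ℕ := fun n => A n + orderOf z + 1
    let L : ℕ → ℕ := fun n => (2 * A n + 1) * (Q n * R n)
    let B : ℕ → ℕ := fun n => (L n * n + 2) ^ k₁
    have hR : PolyBound R := polyBound_pow k₀
    have hA : PolyBound A := ((hR.mul PolyBound.id).add (PolyBound.const 2)).pow k₁
    have hQ : PolyBound Q := (hA.add (PolyBound.const _)).add (PolyBound.const 1)
    have hL : PolyBound L :=
      (((PolyBound.const 2).mul hA).add (PolyBound.const 1)).mul (hQ.mul hR)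
    have hB : PolyBound B := ((hL.mul PolyBound.id).add (PolyBound.const 2)).pow k₁
    obtain ⟨k, hk⟩ : PolyBound fun n =>
        (2 * R n + 2) + (Q n * R n + A n * R n) + (B n * R n + L n) :=
      ((((PolyBound.const 2).mul hR).add (PolyBound.const 2)).add
        ((hQ.mul hR).add (hA.mul hR))).add ((hB.mul hR).add hL)
    refine ⟨k, fun n ι x hx u hu => ?_⟩
    have hkn : (2 * R n + 2) + (Q n * R n + A n * R n) + (B n * R n + L n) ≤ (n + 2) ^ k := hk n
    set Φ := FreeGroup.lift x
    set X : Set (FreeGroup ι) := Set.range FreeGroup.of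
    set V := shortKer (f.comp Φ) X (R n)
    have hV1 : (1 : FreeGroup ι) ∈ V := ⟨one_mem _, one_mem_wordBall⟩
    have hVz : ∀ w ∈ V, ∃ a : ℤ, a.natAbs ≤ A n ∧ z ^ a = Φ w := fun w hw =>
      hk₁ _ (Φ w) hw.1 (lift_mem_wordBall hx hw.2)
    have huV : u ∈ normalClosure V := by
      have := hk₀ n ι (fun i => f (x i)) (fun i => map_mem_wordBall f (hx i))
      rw [lift_comp_eq] at this
      refine this ?_
      rw [MonoidHom.mem_ker, MonoidHom.comp_apply, MonoidHom.mem_ker.1 hu, map_one]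
    obtain ⟨b, hb, q, hq, hqQ, hVq, hbs⟩ : ∃ b ∈ V, ∃ q : ℕ, 0 < q ∧ q ≤ Q n ∧
        (∀ w ∈ V, ∃ s : ℤ, s.natAbs ≤ A n ∧ Φ w ^ q = Φ b ^ s) ∧
        ∀ (s : ℤ) (v : FreeGroup ι), v ∈ wordBall X (L n) → Φ (b ^ s * v) = 1 →
          ∃ s' : ℤ, s'.natAbs ≤ B n ∧ b ^ s' = b ^ s := by
      by_cases hcase : ∃ q : ℕ, 0 < q ∧ q ≤ Q n ∧ ∀ w ∈ V, Φ w ^ q = 1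
      · obtain ⟨q, hq, hqQ, hVq⟩ := hcase
        exact ⟨1, hV1, q, hq, hqQ, fun w hw => ⟨0, by simp, by simpa using hVq w hw⟩,
          fun s v _ _ => ⟨0, by simp, by simp⟩⟩
      · have hzinf : Function.Injective fun a : ℤ => z ^ a := by
          rw [injective_zpow_iff_not_isOfFinOrder, ← orderOf_pos_iff]
          intro hpos
          refine hcase ⟨orderOf z, hpos, by simp only [Q]; omega, fun w hw => ?_⟩
          obtain ⟨a, -, ha⟩ := hVz w hw
          rw [← ha, ← zpow_natCast, ← zpow_mul, mul_comm, zpow_mul, zpow_natCast,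
            pow_orderOf_eq_one, one_zpow]
        obtain ⟨b, hb, hb1⟩ : ∃ b ∈ V, Φ b ≠ 1 := by
          by_contra! hcon
          exact hcase ⟨1, one_pos, by simp only [Q]; omega, fun w hw => by rw [hcon w hw, one_pow]⟩
        obtain ⟨t, ht, hbt⟩ := hVz b hb
        have ht0 : t ≠ 0 := by
          rintro rfl
          exact hb1 (by rw [← hbt, zpow_zero])
        refine ⟨b, hb, t.natAbs, Int.natAbs_pos.2 ht0, by simp only [Q]; omega, fun w hw => ?_,
          fun s v hv hsv => ⟨s, ?_, rfl⟩⟩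
        · obtain ⟨a, ha, haw⟩ := hVz w hw
          rcases Int.natAbs_eq t with h | h
          · refine ⟨a, ha, ?_⟩
            rw [← haw, ← hbt, ← zpow_natCast, ← zpow_mul, ← zpow_mul, ← h, mul_comm]
          · refine ⟨-a, by omega, ?_⟩
            rw [← haw, ← hbt, ← zpow_natCast, ← zpow_mul, ← zpow_mul]
            congr 1
            rw [show (t.natAbs : ℤ) = -t by omega]
            ring
        · have hvs : z ^ (t * s) = (Φ v)⁻¹ := by
            rw [map_mul, map_zpow, ← hbt, ← zpow_mul] at hsv
            exact eq_inv_of_mul_eq_one_left hsv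
          obtain ⟨a, ha, hav⟩ := hk₁ _ (z ^ (t * s)) (hker ▸ zpow_mem (mem_zpowers z) _)
            (hvs ▸ inv_mem_wordBall (lift_mem_wordBall hx hv))
          obtain rfl := hzinf hav
          rw [Int.natAbs_mul] at ha
          exact (Nat.le_mul_of_pos_left _ (Int.natAbs_pos.2 ht0)).trans ha
    exact mem_normalClosure_shortKer (FreeGroup.closure_range_of ι) (fun w hw => hw.2) hV1 hVz hz hb
      hq hqQ hVq hbs (by omega) (by omega) (show B n * R n + L n ≤ _ by omega) hu huV

/-- If the subgroup `P` is generated by elements of the ball of radius `n`, then some exponent `m`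
of polynomially bounded size satisfies `y ^ m ∈ P` for every `y` with a nontrivial power in `P`. -/
theorem exists_pow_mem_range_lift (d : ℕ) {N : Type u} [Group N] [Group.IsNilpotent N]
    (h : HasCyclicCentralSeries d N) {S : Set N} (hS : S.Finite) :
    ∃ k : ℕ, ∀ (n : ℕ) (ι : Type v) (x : ι → N), (∀ i, x i ∈ wordBall S n) →
      ∃ m : ℕ, 0 < m ∧ m ≤ (n + 2) ^ k ∧ ∀ (y : N) (j : ℕ), 0 < j →
        y ^ j ∈ (FreeGroup.lift x).range → y ^ m ∈ (FreeGroup.lift x).range := by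
  induction d generalizing N with
  | zero =>
    have hN : Subsingleton N := h
    refine ⟨0, fun n ι x _ => ⟨1, one_pos, by simp, fun y j _ _ => ?_⟩⟩
    rw [Subsingleton.elim (y ^ 1) 1]
    exact one_mem _
  | succ d ih =>
    obtain ⟨N', _, f, z, hf, hz, hker, h'⟩ := h
    have : Group.IsNilpotent N' := Group.nilpotent_of_surjective f hf
    obtain ⟨k, hk⟩ := ih h' (hS.image f)
    obtain ⟨k₀, hk₀⟩ := exists_ker_lift_le_normalClosure.{u, v} d h' (hS.image f)
    obtain ⟨k₁, hk₁⟩ := exists_zpow_eq_of_mem_wordBall h' hS f hf hker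
    let R : ℕ → ℕ := fun n => (n + 2) ^ k₀
    let A : ℕ → ℕ := fun n => (R n * n + 2) ^ k₁
    have hA : PolyBound A :=
      (((polyBound_pow k₀).mul PolyBound.id).add (PolyBound.const 2)).pow k₁
    obtain ⟨k', hk'⟩ : PolyBound fun n => (n + 2) ^ k * (A n + orderOf z + 1) :=
      (polyBound_pow k).mul ((hA.add (PolyBound.const _)).add (PolyBound.const 1))
    refine ⟨k', fun n ι x hx => ?_⟩
    have hfx : ∀ i, f (x i) ∈ wordBall (f '' S) n := fun i => map_mem_wordBall f (hx i)
    obtain ⟨m, hm0, hm, hroot⟩ := hk n ι (fun i => f (x i)) hfx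
    have hpres := hk₀ n ι (fun i => f (x i)) hfx
    rw [lift_comp_eq] at hroot hpres
    set Φ := FreeGroup.lift x
    have hcz : ∀ (a : ℤ) (g : N), Commute g (z ^ a) := fun a g =>
      mem_center_iff.1 (zpow_mem hz a) g
    have hstep : ∀ (y : N) (j : ℕ), 0 < j → y ^ j ∈ Φ.range →
        ∃ p ∈ Φ.range, ∃ i : ℤ, y ^ m = p * z ^ i := by
      intro y j hj hy
      have h1 : f y ^ j ∈ (f.comp Φ).range := by
        obtain ⟨w, hw⟩ := hy
        exact ⟨w, by rw [MonoidHom.comp_apply, hw, map_pow]⟩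
      obtain ⟨w, hw⟩ := hroot (f y) j hj h1
      have h2 : (Φ w)⁻¹ * y ^ m ∈ f.ker := by
        rw [MonoidHom.mem_ker, map_mul, map_inv, map_pow, inv_mul_eq_one]
        exact hw
      rw [hker] at h2
      obtain ⟨i, hi⟩ := h2
      change z ^ i = _ at hi
      exact ⟨Φ w, ⟨w, rfl⟩, i, by rw [hi, mul_inv_cancel_left]⟩
    have hconcl : ∀ q : ℕ, 0 < q → q ≤ A n + orderOf z + 1 → z ^ q ∈ Φ.range →
        ∃ m : ℕ, 0 < m ∧ m ≤ (n + 2) ^ k' ∧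
          ∀ (y : N) (j : ℕ), 0 < j → y ^ j ∈ Φ.range → y ^ m ∈ Φ.range := by
      intro q hq0 hq hzq
      refine ⟨m * q, Nat.mul_pos hm0 hq0, (Nat.mul_le_mul hm hq).trans (hk' n),
        fun y j hj hy => ?_⟩
      obtain ⟨p, hp, i, hpi⟩ := hstep y j hj hy
      rw [pow_mul, hpi, (hcz i p).mul_pow]
      refine mul_mem (pow_mem hp q) ?_
      rw [← zpow_natCast, ← zpow_mul, mul_comm, zpow_mul, zpow_natCast]
      exact zpow_mem hzq i
    by_cases hfin : 0 < orderOf z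
    · exact hconcl (orderOf z) hfin (by omega) (by rw [pow_orderOf_eq_one]; exact one_mem _)
    by_cases hrel : ∃ w ∈ shortKer (f.comp Φ) (Set.range FreeGroup.of) ((n + 2) ^ k₀), Φ w ≠ 1
    · obtain ⟨w, ⟨hwk, hwR⟩, hw1⟩ := hrel
      obtain ⟨a, ha, haw⟩ := hk₁ _ (Φ w) hwk (lift_mem_wordBall hx hwR)
      have ha0 : a ≠ 0 := by
        rintro rfl
        exact hw1 (by rw [← haw, zpow_zero])
      have haA : a.natAbs ≤ A n := ha
      refine hconcl a.natAbs (Int.natAbs_pos.2 ha0) (by omega) ?_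
      rw [← zpow_natCast]
      rcases Int.natAbs_eq a with h | h
      · rw [← h, haw]
        exact ⟨w, rfl⟩
      · rw [show (a.natAbs : ℤ) = -a by omega, zpow_neg, haw]
        exact inv_mem ⟨w, rfl⟩
    · push Not at hrel
      have hker' : (f.comp Φ).ker ≤ Φ.ker := hpres.trans (normalClosure_le_normal hrel)
      have hm1 : m ≤ (n + 2) ^ k' :=
        (Nat.le_mul_of_pos_right m (by omega : 0 < A n + orderOf z + 1)).trans
          ((Nat.mul_le_mul_right _ hm).trans (hk' n))
      refine ⟨m, hm0, hm1, fun y j hj hy => ?_⟩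
      obtain ⟨p, ⟨w, rfl⟩, i, hpi⟩ := hstep y j hj hy
      obtain ⟨w', hw'⟩ := hy
      have hzij : Φ (w ^ j)⁻¹ * Φ w' ^ m = z ^ (i * j) := by
        rw [hw', ← pow_mul, mul_comm, pow_mul, hpi, (hcz i _).mul_pow, map_inv, map_pow,
          inv_mul_cancel_left, zpow_mul, zpow_natCast]
      have h1 : Φ ((w ^ j)⁻¹ * w' ^ m) = 1 := by
        apply hker'
        rw [MonoidHom.mem_ker, MonoidHom.comp_apply, map_mul, map_pow, hzij, ← MonoidHom.mem_ker,
          hker]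
        exact zpow_mem (mem_zpowers z) _
      rw [map_mul, map_pow, hzij] at h1
      have hinj : Function.Injective fun a : ℤ => z ^ a := by
        rw [injective_zpow_iff_not_isOfFinOrder, ← orderOf_pos_iff]
        exact hfin
      have hij : i * j = 0 := hinj (by simpa using h1)
      have hi : i = 0 := (mul_eq_zero.1 hij).resolve_right (by omega)
      rw [hpi, hi, zpow_zero, mul_one]
      exact ⟨w, rfl⟩

/-! ### Separation -/

/-- A proper subgroup of a nilpotent group is contained in a proper normal subgroup. -/
theorem exists_normal_ge_ne_top {G : Type*} [Group G] [Group.IsNilpotent G] {H : Subgroup G}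
    (hH : H ≠ ⊤) : ∃ M : Subgroup G, M.Normal ∧ H ≤ M ∧ M ≠ ⊤ := by
  obtain ⟨c, hc⟩ := Group.IsNilpotent.nilpotent G
  have key : ∀ j, H ⊔ Subgroup.upperCentralSeries G j = ⊤ →
      ∃ M : Subgroup G, M.Normal ∧ H ≤ M ∧ M ≠ ⊤ := by
    intro j
    induction j with
    | zero => exact fun h => absurd (by simpa using h) hH
    | succ j ih =>
      intro h
      by_cases hj : H ⊔ Subgroup.upperCentralSeries G j = ⊤
      · exact ih hj
      refine ⟨_, ⟨fun n hn g => ?_⟩, le_sup_left, hj⟩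
      have hg : g ∈ H ⊔ Subgroup.upperCentralSeries G (j + 1) := h ▸ mem_top g
      obtain ⟨a, ha, z, hz, rfl⟩ := mem_sup_of_normal_right.1 hg
      have h1 : z * n * z⁻¹ ∈ H ⊔ Subgroup.upperCentralSeries G j := by
        have := Subgroup.mem_upperCentralSeries_succ_iff.1 hz n
        have h2 := mul_mem (mem_sup_right (S := H) this) hn
        rwa [commutatorElement_def, inv_mul_cancel_right] at h2
      have h3 := mul_mem (mul_mem (mem_sup_left (T := Subgroup.upperCentralSeries G j) ha) h1)
        (inv_mem (mem_sup_left (T := Subgroup.upperCentralSeries G j) ha))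
      rwa [show a * (z * n * z⁻¹) * a⁻¹ = a * z * n * (a * z)⁻¹ by group] at h3
  exact key c (by rw [hc, sup_top_eq])

/-- The exponent sum of a distinguished generator. -/
noncomputable def exponentSum (ι : Type*) : FreeGroup (Option ι) →* Multiplicative ℤ :=
  FreeGroup.lift fun i => i.elim (Multiplicative.ofAdd 1) fun _ => 1

theorem natAbs_exponentSum_le {ι : Type*} {w : FreeGroup (Option ι)} {R : ℕ}
    (hw : w ∈ wordBall (Set.range FreeGroup.of) R) :
    (Multiplicative.toAdd (exponentSum ι w)).natAbs ≤ R := by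
  refine wordBall_induction (motive := fun R w =>
    (Multiplicative.toAdd (exponentSum ι w)).natAbs ≤ R) (fun _ => by simp)
    (fun R y w hy _ ih => ?_) hw
  have h1 : ∀ i, (Multiplicative.toAdd (exponentSum ι (FreeGroup.of i))).natAbs ≤ 1 := by
    rintro (_ | i) <;> simp [exponentSum]
  have h2 : (Multiplicative.toAdd (exponentSum ι y)).natAbs ≤ 1 := by
    rcases hy with ⟨i, rfl⟩ | ⟨i, hi⟩
    · exact h1 i
    · have := h1 i
      rwa [hi, map_inv, toAdd_inv, Int.natAbs_neg] at this
  rw [map_mul, toAdd_mul]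
  exact (Int.natAbs_add_le _ _).trans (by omega)

/-- If `g ∉ H` and `⟨H, g⟩` is presented by relators of length at most `R`, then `g` is not in some
subgroup `M ≥ H` which contains the `e`-th powers of `⟨H, g⟩`, where `e ≤ R + 2`. -/
theorem exists_subgroup_separating {N : Type*} [Group N] [Group.IsNilpotent N] {ι : Type*}
    (x : Option ι → N) {R : ℕ}
    (hR : (FreeGroup.lift x).ker ≤
      normalClosure (shortKer (FreeGroup.lift x) (Set.range FreeGroup.of) R))
    (hg : x none ∉ closure (Set.range fun i => x (some i))) :
    ∃ (M : Subgroup N) (e : ℕ), 0 < e ∧ e ≤ R + 2 ∧ (∀ i, x (some i) ∈ M) ∧ x none ∉ M ∧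
      ∀ y ∈ (FreeGroup.lift x).range, y ^ e ∈ M := by
  set Φ := FreeGroup.lift x
  have hΦ : ∀ i, Φ (FreeGroup.of i) = x i := fun i => FreeGroup.lift_apply_of
  set η := exponentSum ι
  have hηn : η (FreeGroup.of none) = Multiplicative.ofAdd 1 := by simp [η, exponentSum]
  have hηs : ∀ i, η (FreeGroup.of (some i)) = 1 := fun i => by simp [η, exponentSum]
  by_cases hrel : ∀ w ∈ shortKer Φ (Set.range FreeGroup.of) R, η w = 1
  · have hker : Φ.ker ≤ η.ker := hR.trans (normalClosure_le_normal hrel)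
    let E : Subgroup (Multiplicative ℤ) := zpowers (Multiplicative.ofAdd 2)
    refine ⟨(E.comap η).map Φ, 2, by omega, by omega, fun i => ?_, ?_, ?_⟩
    · exact ⟨FreeGroup.of (some i), by simp [hηs, one_mem], hΦ _⟩
    · rintro ⟨w, hw, hwx⟩
      have h1 : w⁻¹ * FreeGroup.of none ∈ η.ker := hker (by
        rw [MonoidHom.mem_ker, map_mul, map_inv, hwx, hΦ, inv_mul_cancel])
      rw [MonoidHom.mem_ker, map_mul, map_inv, inv_mul_eq_one, hηn] at h1
      obtain ⟨k, hk⟩ : η w ∈ E := hw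
      rw [h1] at hk
      have := congrArg Multiplicative.toAdd hk
      simp at this
      omega
    · rintro _ ⟨w, rfl⟩
      refine ⟨w ^ 2, ?_, map_pow Φ w 2⟩
      refine ⟨Multiplicative.toAdd (η w), ?_⟩
      apply Multiplicative.toAdd.injective
      simp [mul_comm]
  · push Not at hrel
    obtain ⟨v, ⟨hvK, hvR⟩, hv1⟩ := hrel
    let P := Φ.range
    let H' : Subgroup P := closure (Set.range fun i => ⟨x (some i), FreeGroup.of (some i), hΦ _⟩)
    have hH'map : H'.map P.subtype = closure (Set.range fun i => x (some i)) := by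
      rw [MonoidHom.map_closure, ← Set.range_comp]
      rfl
    have hH' : H' ≠ ⊤ := by
      intro htop
      apply hg
      rw [← hH'map, htop]
      exact ⟨⟨x none, FreeGroup.of none, hΦ _⟩, mem_top _, rfl⟩
    obtain ⟨M, hM, hHM, hMtop⟩ := exists_normal_ge_ne_top hH'
    let Ψ : FreeGroup (Option ι) →* P := Φ.rangeRestrict
    let π := (QuotientGroup.mk' M).comp Ψ
    have hπs : ∀ i, π (FreeGroup.of (some i)) = 1 := by
      intro i
      rw [MonoidHom.comp_apply, ← MonoidHom.mem_ker, QuotientGroup.ker_mk']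
      exact hHM (subset_closure ⟨i, Subtype.ext (hΦ _).symm⟩)
    have hπη : ∀ w, π w = π (FreeGroup.of none) ^ Multiplicative.toAdd (η w) := by
      have : π = (zpowersHom _ (π (FreeGroup.of none))).comp η := by
        apply FreeGroup.ext_hom
        rintro (_ | i)
        · rw [MonoidHom.comp_apply (zpowersHom _ _), hηn, zpowersHom_apply, toAdd_ofAdd, zpow_one]
        · rw [MonoidHom.comp_apply (zpowersHom _ _), hηs, map_one, hπs]
      intro w
      conv_lhs => rw [this]
      rw [MonoidHom.comp_apply, zpowersHom_apply]
    set t := Multiplicative.toAdd (η v)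
    have ht0 : t ≠ 0 := fun h => hv1 (Multiplicative.toAdd.injective h)
    have hvΨ : π v = 1 := by
      have : Ψ v = 1 := Subtype.ext hvK
      rw [MonoidHom.comp_apply, this, map_one]
    have hgt : π (FreeGroup.of none) ^ t.natAbs = 1 := by
      have h1 : π (FreeGroup.of none) ^ t = 1 := (hπη v).symm.trans hvΨ
      rcases Int.natAbs_eq t with h | h
      · rw [← zpow_natCast, ← h, h1]
      · rw [← zpow_natCast, show (t.natAbs : ℤ) = -t by omega, zpow_neg, h1, inv_one]
    have hpow : ∀ p : P, p ^ t.natAbs ∈ M := by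
      intro p
      obtain ⟨w, rfl⟩ := Φ.rangeRestrict_surjective p
      rw [← QuotientGroup.ker_mk' M, MonoidHom.mem_ker, map_pow]
      change π w ^ _ = 1
      rw [hπη w, ← zpow_natCast, ← zpow_mul, mul_comm, zpow_mul, zpow_natCast, hgt, one_zpow]
    refine ⟨M.map P.subtype, t.natAbs, Int.natAbs_pos.2 ht0,
      (natAbs_exponentSum_le hvR).trans (by omega), fun i => ?_, ?_, ?_⟩
    · exact ⟨⟨x (some i), FreeGroup.of (some i), hΦ _⟩, hHM (subset_closure ⟨i, rfl⟩), rfl⟩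
    · rintro ⟨p, hp, hpx⟩
      apply hMtop
      have hpn : π (FreeGroup.of none) = 1 := by
        rw [MonoidHom.comp_apply, ← MonoidHom.mem_ker, QuotientGroup.ker_mk']
        have : Ψ (FreeGroup.of none) = p := Subtype.ext ((hΦ _).trans hpx.symm)
        rwa [this]
      rw [eq_top_iff]
      intro p _
      obtain ⟨w, rfl⟩ := Φ.rangeRestrict_surjective p
      rw [← QuotientGroup.ker_mk' M, MonoidHom.mem_ker]
      exact (hπη w).trans (by rw [hpn, one_zpow])
    · rintro y hy
      exact ⟨⟨y, hy⟩ ^ t.natAbs, hpow _, rfl⟩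

theorem depth_le_index {G : Type u} [Group G] {H L : Subgroup G} [L.Normal] {g : G}
    (hL : L.index ≠ 0) (hg : ∀ h ∈ H, ∀ l ∈ L, h * l ≠ g) : depth H g ≤ L.index := by
  have : L.FiniteIndex := ⟨hL⟩
  have : Countable (G ⧸ L) := Finite.to_countable
  let e : Shrink.{0} (G ⧸ L) ≃* (G ⧸ L) := Shrink.mulEquiv
  let π : G →* Shrink.{0} (G ⧸ L) := e.symm.toMonoidHom.comp (QuotientGroup.mk' L)
  refine sInf_le ⟨Shrink.{0} (G ⧸ L), inferInstance, Finite.of_equiv _ e.symm.toEquiv, π, ?_, ?_⟩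
  · rintro ⟨h, hh, hπ⟩
    have : QuotientGroup.mk' L h = QuotientGroup.mk' L g := e.symm.injective hπ
    exact hg h hh _ (QuotientGroup.eq.1 this) (mul_inv_cancel_left h g)
  · rw [Nat.card_congr e.toEquiv]
    rfl

/-- Subgroups of finitely generated nilpotent groups are separated by quotients of polynomial
order. -/
theorem exists_depth_le (N : Type u) [Group N] [Group.IsNilpotent N] {S : Finset N}
    (hS : closure (S : Set N) = ⊤) :
    ∃ k : ℕ, ∀ (n : ℕ) (H : Subgroup N) (g : N), g ∉ H → subgroupNorm S H ≤ n →
      wordNorm S g ≤ n → depth H g ≤ ((n + 2) ^ k : ℕ) := by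
  obtain ⟨d, hd⟩ := exists_hasCyclicCentralSeries S.finite_toSet hS
  obtain ⟨k₀, hk₀⟩ := exists_ker_lift_le_normalClosure.{u, u} d hd S.finite_toSet
  obtain ⟨k₁, hk₁⟩ := exists_pow_mem_range_lift.{u, u} d hd S.finite_toSet
  obtain ⟨E, hE⟩ := exists_pow_eq_of_mem_closure_pow N
  obtain ⟨k, hk⟩ : PolyBound fun n => (((n + 2) ^ k₁ * ((n + 2) ^ k₀ + 2)) ^ E) ^ d :=
    (((polyBound_pow k₁).mul ((polyBound_pow k₀).add (PolyBound.const 2))).pow E).pow d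
  refine ⟨k, fun n H g hgH hHn hgn => ?_⟩
  obtain ⟨X, rfl, hXn⟩ := exists_of_subgroupNorm_le hHn
  let x : Option X → N := fun i => i.elim g (fun y => y)
  have hx : ∀ i, x i ∈ wordBall (S : Set N) n := by
    rintro (_ | y)
    · exact wordNorm_le_iff.1 hgn
    · exact hXn y y.2
  have hXr : (Set.range fun y : X => x (some y)) = X := Subtype.range_coe
  obtain ⟨M, e, he0, he, hHM, hgM, hpow⟩ := exists_subgroup_separating x (hk₀ n _ x hx)
    (by rw [hXr]; exact hgH)
  obtain ⟨m, hm0, hm, hroot⟩ := hk₁ n _ x hx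
  let L : Subgroup N := closure (Set.range fun y : N => y ^ (m * e) ^ E)
  have hL : L.Normal := by
    refine ⟨fun l hl a => ?_⟩
    have h1 : L.map (MulAut.conj a).toMonoidHom ≤ L := by
      rw [MonoidHom.map_closure, closure_le]
      rintro _ ⟨_, ⟨y, rfl⟩, rfl⟩
      exact subset_closure ⟨a * y * a⁻¹, by simp⟩
    exact h1 ⟨l, hl, by simp⟩
  obtain ⟨hi0, hi⟩ := index_le_of_pow_mem d hd L (M := (m * e) ^ E)
    (Nat.pow_pos (Nat.mul_pos hm0 he0)) (fun y => subset_closure ⟨y, rfl⟩)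
  have hcl : closure (X : Set N) ≤ M := by
    rw [closure_le]
    exact fun y hy => hHM ⟨y, hy⟩
  have hclP : closure (X : Set N) ≤ (FreeGroup.lift x).range := by
    rw [closure_le]
    exact fun y hy => ⟨FreeGroup.of (some ⟨y, hy⟩), FreeGroup.lift_apply_of⟩
  refine (depth_le_index hi0 (fun h hh l hl hhl => ?_)).trans ?_
  · obtain ⟨y, rfl⟩ := hE (m * e) l hl
    have hyP : y ^ (m * e) ∈ (FreeGroup.lift x).range := by
      have hgP : g ∈ (FreeGroup.lift x).range := ⟨FreeGroup.of none, FreeGroup.lift_apply_of⟩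
      rw [← hhl] at hgP
      exact (mul_mem_cancel_left (hclP hh)).1 hgP
    have hym := hpow _ (hroot y (m * e) (Nat.mul_pos hm0 he0) hyP)
    rw [← pow_mul] at hym
    exact hgM (hhl ▸ mul_mem (hcl hh) hym : g ∈ M)
  · have h1 : m * e ≤ (n + 2) ^ k₁ * ((n + 2) ^ k₀ + 2) := Nat.mul_le_mul hm he
    exact_mod_cast hi.trans ((Nat.pow_le_pow_left (Nat.pow_le_pow_left h1 E) d).trans (hk n))

/-! ### The lower bound -/

theorem le_depth_zpowers_pow {G : Type*} [Group G] (z : G) {p : ℕ} (hp : p.Prime) :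
    (p : ℕ∞) ≤ depth (zpowers (z ^ p)) z := by
  refine le_sInf ?_
  rintro _ ⟨Q, _, _, π, hπ, rfl⟩
  rw [MonoidHom.map_zpowers, map_pow] at hπ
  have hdvd : p ∣ orderOf (π z) := by
    by_contra hnd
    obtain ⟨m, hm⟩ := exists_pow_eq_self_of_coprime ((Nat.Prime.coprime_iff_not_dvd hp).2 hnd)
    exact hπ ⟨m, by simpa using hm⟩
  exact_mod_cast Nat.le_of_dvd Nat.card_pos (hdvd.trans (orderOf_dvd_natCard _))

theorem dominated_id_sepFun {N : Type*} [Group N] {S : Finset N}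
    (hS : closure (S : Set N) = ⊤) {z : N} (hz : ¬ IsOfFinOrder z) :
    Dominated (fun n => (n : ℕ∞)) (sepFun S) := by
  obtain ⟨c, hc⟩ := exists_mem_wordBall (show z ∈ closure (S : Set N) from hS ▸ mem_top z)
  refine ⟨2 * c + 1, fun n => ?_⟩
  rcases Nat.eq_zero_or_pos n with rfl | hn
  · simp
  obtain ⟨p, hp, hnp, hpn⟩ := Nat.exists_prime_lt_and_le_two_mul n hn.ne'
  have h1 : (n : ℕ∞) ≤ sepFun S ((2 * c + 1) * n) := by
    refine le_trans ((Nat.cast_le.2 hnp.le).trans (le_depth_zpowers_pow z hp)) (le_sSup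
      ⟨zpowers (z ^ p), z, (Subgroup.fg_iff _).2 ⟨{z ^ p}, (zpowers_eq_closure _).symm, by simp⟩,
        ?_, ?_, ?_, rfl⟩)
    · rintro ⟨k, hk⟩
      have hinj := injective_zpow_iff_not_isOfFinOrder.2 hz
      have h2 : (p : ℤ) * k = 1 := hinj (by
        change z ^ ((p : ℤ) * k) = z ^ (1 : ℤ)
        rw [zpow_mul, zpow_natCast, zpow_one]
        exact hk)
      have h3 : (p : ℤ) ∣ 1 := ⟨k, h2.symm⟩
      exact hp.one_lt.ne' (Nat.dvd_one.1 (by exact_mod_cast h3))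
    · refine (iInf₂_le {z ^ p} (by rw [Finset.coe_singleton, zpowers_eq_closure])).trans ?_
      rw [finsetNorm, Finset.sup_singleton, wordNorm_le_iff]
      refine wordBall_mono ?_ (pow_mem_wordBall hc p)
      nlinarith [Nat.mul_le_mul_right c hpn]
    · rw [wordNorm_le_iff]
      refine wordBall_mono ?_ hc
      nlinarith
  calc (n : ℕ∞) ≤ sepFun S ((2 * c + 1) * n) := h1
    _ = 1 * sepFun S ((2 * c + 1) * n) := (one_mul _).symm
    _ ≤ _ := mul_le_mul_left (by exact_mod_cast (by omega : 1 ≤ 2 * c + 1)) _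

theorem dominated_sepFun_pow {N : Type*} [Group N] [Group.IsNilpotent N] {S : Finset N}
    (hS : closure (S : Set N) = ⊤) :
    ∃ k : ℕ, Dominated (sepFun S) fun n => (n : ℕ∞) ^ k := by
  obtain ⟨k, hk⟩ := exists_depth_le N hS
  refine ⟨k, 3, fun n => sSup_le ?_⟩
  rintro _ ⟨H, g, -, hg, hH, hgn, rfl⟩
  rcases Nat.eq_zero_or_pos n with rfl | hn
  · obtain ⟨l, -, rfl, hl⟩ := wordNorm_le_iff.1 hgn
    obtain rfl := List.eq_nil_of_length_eq_zero (Nat.le_zero.1 hl)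
    exact absurd (one_mem H) hg
  · refine (hk n H g hg hH hgn).trans ?_
    have h1 : (n + 2) ^ k ≤ 3 * (3 * n) ^ k :=
      (Nat.pow_le_pow_left (by omega) k).trans (Nat.le_mul_of_pos_left _ (by omega))
    change (((n + 2) ^ k : ℕ) : ℕ∞) ≤ ((3 : ℕ) : ℕ∞) * ((3 * n : ℕ) : ℕ∞) ^ k
    exact_mod_cast h1

end SubgroupSeparability

theorem theorem1p2 {N : Type*} [Group N] [Nontrivial N] [Group.IsNilpotent N]
    (htf : ∀ g : N, g ≠ 1 → ¬ IsOfFinOrder g)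
    (S : Finset N) (hS : Subgroup.closure (S : Set N) = ⊤) :
    ∃ k : ℕ,
      SubgroupSeparability.Dominated (fun n => (n : ℕ∞)) (SubgroupSeparability.sepFun S) ∧
      SubgroupSeparability.Dominated (SubgroupSeparability.sepFun S)
        (fun n => (n : ℕ∞) ^ k) := by
  obtain ⟨z, hz⟩ := exists_ne (1 : N)
  obtain ⟨k, hk⟩ := SubgroupSeparability.dominated_sepFun_pow hS
  exact ⟨k, SubgroupSeparability.dominated_id_sepFun hS (htf z hz), hk⟩
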